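/- Let $\Bbbk$ be a field of characteristic $2$, let $m\ge 1$, $n=2m+1$, and let $E$ be a $\Bbbk$-vector space of dimension $n$ with a volume form, given by a basis $e_1,\dots,e_n$ with $e_1\wedge\cdots\wedge e_n\mapsto 1$. Let $(q_0,q_1)$ be a regular pair of quadratic forms on $E$, i.e. $q_0,q_1$ are linearly independent and the base locus $V(q_0)\cap V(q_1)\subset\mathbb P(E)\cong\mathbb P^{n-1}$ is smooth of codimension $2$; let $b_0,b_1$ be the polar forms, $b_j(v,w)=q_j(v+w)-q_j(v)-q_j(w)$. Let $\Omega(t_0,t_1)=\sum_j \mathrm{Pf}_j\,e_j$, where $\mathrm{Pf}_j$ is the Pfaffian of the matrix of $t_0b_0+t_1b_1$ with the $j$-th row and column deleted, and write $\Omega=\sum_{i=0}^m t_0^{m-i}t_1^i\,\omega_i$ with $\omega_i\in E$. Let $$\Delta(t_0,t_1)=(t_0q_0+t_1q_1)(\Omega(t_0,t_1))=\sum_{i=0}^n a_it_0^{n-i}t_1^i$$ be the half-discriminant of the pair, and let $f(T)=\Delta(1,T)=\sum_{i=0}^n a_iT^i$ be its dehomogenization. Assume that $a_n\neq 0$ (equivalently,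 that $q_1$ is nondegenerate). Put $A=\Bbbk[T]/(f)$, let $t$ be the class of $T$, put $d_i=a_{i+1}+a_{i+2}t+\cdots+a_nt^{n-1-i}$ for $0\le i\le n-1$, let $\mathrm{Idem}(A)=\{a\in A: a^2=a\}$, a subgroup of $(A,+)$, and let $\langle 1\rangle$ be its subgroup generated by $1$. Let $\mathrm{Aut}(q_0,q_1)$ be the group of all $g\in\mathrm{GL}(E)$ with $q_0(gv)=q_0(v)$ and $q_1(gv)=q_1(v)$ for all $v\in E$. A Kronecker basis is a basis $(w_0,\dots,w_m,v_0,\dots,v_{m-1})$ of $E$ with $w_i=\omega_i$ for all $i$ and, for $j=0,1$ and all valid indices, $b_j(w_i,w_l)=0$, $b_j(v_i,v_l)=0$, $b_0(w_i,v_l)=\delta_{i,l+1}$, $b_1(w_i,v_l)=\delta_{il}$. Then Kronecker bases exist, and there is a canonical group isomorphism $$\mathrm{Idem}(A)/\langle 1\rangle\;\cong\;\mathrm{Aut}(q_0,q_1).$$ It is canonical in the sense that, for every Kronecker basis, the class of an idempotent $\epsilon=\sum_{i=0}^{n-1}s_id_i$ (with $s_i\in\Bbbk$) is sent to the automorphism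 $g$ with $g(w_i)=w_i$ for $0\le i\le m$ and $g(v_i)=v_i+\sum_{j=0}^m s_{i+j}w_j$ for $0\le i\le m-1$. Consequently $\mathrm{Aut}(q_0,q_1)$ is an elementary abelian $2$-group (it is commutative and $g^2=1$ for all its elements $g$) of order $2^{l-1}$, where $l$ is the number of distinct monic irreducible factors of $f$ in $\Bbbk[T]$. -/

import Mathlib

open Polynomial

noncomputable section

namespace QuadPencil

/-- The Pfaffian of an alternating `2m × 2m` matrix, by expansion along the first row. -/
def pfaffian {R : Type*} [CommRing R] :
    (m : ℕ) → Matrix (Fin (2 * m)) (Fin (2 * m)) R → R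
  | 0, _ => 1
  | m + 1, M => ∑ j : Fin (2 * m + 1), (-1) ^ (j : ℕ) * M 0 j.succ *
      pfaffian m (M.submatrix (fun i => (j.succAbove i).succ) (fun i => (j.succAbove i).succ))

variable {k : Type*} [Field k] {E : Type*} [AddCommGroup E] [Module k E] {m : ℕ}

/-- The quadratic form `q` as a homogeneous polynomial `∑_{i ≤ j} a_{ij} x_i x_j` in the
coordinates of the basis `e`. -/
def formPoly (e : Module.Basis (Fin (2 * m + 1)) k E) (q : QuadraticForm k E) :
    MvPolynomial (Fin (2 * m + 1)) k :=
  ∑ i, MvPolynomial.C (q (e i)) * MvPolynomial.X i ^ 2 +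
    ∑ i, ∑ j ∈ Finset.Ioi i,
      MvPolynomial.C (QuadraticMap.polar q (e i) (e j)) * MvPolynomial.X i * MvPolynomial.X j

/-- The pair `(q₀, q₁)` spans a pencil whose base locus `V(q₀) ∩ V(q₁)` in projective space is
smooth (of codimension two): at every geometric point of the base locus the Jacobian matrix has
rank two. -/
def IsRegularPair (e : Module.Basis (Fin (2 * m + 1)) k E) (q₀ q₁ : QuadraticForm k E) : Prop :=
  LinearIndependent k ![q₀, q₁] ∧
  ∀ c : Fin (2 * m + 1) → AlgebraicClosure k, c ≠ 0 →
    MvPolynomial.aeval c (formPoly e q₀) = 0 →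
    MvPolynomial.aeval c (formPoly e q₁) = 0 →
    LinearIndependent (AlgebraicClosure k)
      ![fun j => MvPolynomial.aeval c (MvPolynomial.pderiv j (formPoly e q₀)),
        fun j => MvPolynomial.aeval c (MvPolynomial.pderiv j (formPoly e q₁))]

/-- The matrix over `k[t₀, t₁]` of the polar form of `t₀ q₀ + t₁ q₁` in the basis `e`. -/
def polarMatrix (e : Module.Basis (Fin (2 * m + 1)) k E) (q₀ q₁ : QuadraticForm k E) :
    Matrix (Fin (2 * m + 1)) (Fin (2 * m + 1)) (MvPolynomial (Fin 2) k) :=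
  fun i j => MvPolynomial.X 0 * MvPolynomial.C (QuadraticMap.polar q₀ (e i) (e j)) +
    MvPolynomial.X 1 * MvPolynomial.C (QuadraticMap.polar q₁ (e i) (e j))

/-- The coordinates in the basis `e` of the radical map `Ω`, for the volume form with
`e₁ ∧ ⋯ ∧ eₙ ↦ 1`: the `j`-th one is the Pfaffian of the polar matrix without its `j`-th row and
column (no signs are needed in characteristic two). -/
def radicalMap (e : Module.Basis (Fin (2 * m + 1)) k E) (q₀ q₁ : QuadraticForm k E) :
    Fin (2 * m + 1) → MvPolynomial (Fin 2) k :=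
  fun j => pfaffian m ((polarMatrix e q₀ q₁).submatrix j.succAbove j.succAbove)

/-- The vector coefficient of `t₀ ^ (m - i) * t₁ ^ i` in the radical map `Ω`. -/
def radicalVector (e : Module.Basis (Fin (2 * m + 1)) k E) (q₀ q₁ : QuadraticForm k E)
    (i : Fin (m + 1)) : E :=
  ∑ j, MvPolynomial.coeff (Finsupp.single 0 (m - (i : ℕ)) + Finsupp.single 1 (i : ℕ))
    (radicalMap e q₀ q₁ j) • e j

/-- The half-discriminant `Δ(t₀, t₁) = (t₀ q₀ + t₁ q₁)(Ω(t₀, t₁))` of the pair. -/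
def halfDisc (e : Module.Basis (Fin (2 * m + 1)) k E) (q₀ q₁ : QuadraticForm k E) :
    MvPolynomial (Fin 2) k :=
  MvPolynomial.X 0 * MvPolynomial.aeval (radicalMap e q₀ q₁) (formPoly e q₀) +
    MvPolynomial.X 1 * MvPolynomial.aeval (radicalMap e q₀ q₁) (formPoly e q₁)

/-- The dehomogenization `f(T) = Δ(1, T) = a₀ + a₁ T + ⋯ + aₙ Tⁿ`. -/
def dehomHalfDisc (e : Module.Basis (Fin (2 * m + 1)) k E) (q₀ q₁ : QuadraticForm k E) : k[X] :=
  MvPolynomial.aeval ![(1 : k[X]), X] (halfDisc e q₀ q₁)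

/-- The algebra `A = k[T]/(f)`. -/
abbrev pencilAlgebra (e : Module.Basis (Fin (2 * m + 1)) k E) (q₀ q₁ : QuadraticForm k E) : Type _ :=
  AdjoinRoot (dehomHalfDisc e q₀ q₁)

/-- The element `d_i = a_{i+1} + a_{i+2} t + ⋯ + a_n t^{n-1-i}` of `A`, where `n = 2m + 1`. -/
def dElem (e : Module.Basis (Fin (2 * m + 1)) k E) (q₀ q₁ : QuadraticForm k E) (i : ℕ) :
    pencilAlgebra e q₀ q₁ :=
  ∑ j ∈ Finset.range (2 * m + 1 - i),
    (dehomHalfDisc e q₀ q₁).coeff (i + 1 + j) • AdjoinRoot.root (dehomHalfDisc e q₀ q₁) ^ j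

/-- `B = (w₀, …, w_m, v₀, …, v_{m-1})` is a Kronecker basis for the polar forms of `(q₀, q₁)`,
normalized by the volume form given by `e`, so that `Ω = ∑ t₀ ^ (m - i) * t₁ ^ i * w_i`. -/
structure IsKroneckerBasis (e : Module.Basis (Fin (2 * m + 1)) k E) (q₀ q₁ : QuadraticForm k E)
    (B : Module.Basis (Fin (m + 1) ⊕ Fin m) k E) : Prop where
  ww₀ : ∀ i j, QuadraticMap.polar q₀ (B (.inl i)) (B (.inl j)) = 0
  ww₁ : ∀ i j, QuadraticMap.polar q₁ (B (.inl i)) (B (.inl j)) = 0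
  vv₀ : ∀ i j, QuadraticMap.polar q₀ (B (.inr i)) (B (.inr j)) = 0
  vv₁ : ∀ i j, QuadraticMap.polar q₁ (B (.inr i)) (B (.inr j)) = 0
  wv₀ : ∀ i j, QuadraticMap.polar q₀ (B (.inl i)) (B (.inr j)) = if i = j.succ then 1 else 0
  wv₁ : ∀ i j, QuadraticMap.polar q₁ (B (.inl i)) (B (.inr j)) = if i = j.castSucc then 1 else 0
  normalized : ∀ i, B (.inl i) = radicalVector e q₀ q₁ i

/-- `Aut(q₀, q₁)`, as a subgroup of `GL(E)`. -/
def pairAut (q₀ q₁ : QuadraticForm k E) : Subgroup (E ≃ₗ[k] E) where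
  carrier := {g | (∀ v, q₀ (g v) = q₀ v) ∧ ∀ v, q₁ (g v) = q₁ v}
  mul_mem' := fun {a b} ha hb =>
    ⟨fun v => (ha.1 (b v)).trans (hb.1 v), fun v => (ha.2 (b v)).trans (hb.2 v)⟩
  one_mem' := ⟨fun _ => rfl, fun _ => rfl⟩
  inv_mem' := fun {a} ha =>
    ⟨fun v => by rw [← ha.1 (a⁻¹ v)]; exact congrArg q₀ (a.apply_symm_apply v),
     fun v => by rw [← ha.2 (a⁻¹ v)]; exact congrArg q₁ (a.apply_symm_apply v)⟩

theorem two_mul_eq_zero (k : Type*) [Field k] [CharP k 2] {A : Type*} [CommRing A] [Algebra k A]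
    (a : A) : 2 * a = 0 := by
  have h : (2 : k) = 0 := by exact_mod_cast CharP.cast_eq_zero k 2
  have h' : (2 : A) = 0 := by rw [← map_ofNat (algebraMap k A) 2, h, map_zero]
  rw [h', zero_mul]

/-- The additive group of idempotents of a commutative algebra in characteristic two. -/
def Idem (k : Type*) [Field k] [CharP k 2] (A : Type*) [CommRing A] [Algebra k A] :
    AddSubgroup A where
  carrier := {a | IsIdempotentElem a}
  zero_mem' := IsIdempotentElem.zero
  add_mem' := fun {a b} ha hb => by
    have ha' : a * a = a := ha
    have hb' : b * b = b := hb
    change (a + b) * (a + b) = a + b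
    linear_combination ha' + hb' + two_mul_eq_zero k (a * b)
  neg_mem' := fun {a} ha => by
    have ha' : a * a = a := ha
    change -a * -a = -a
    linear_combination ha' + two_mul_eq_zero k a

/-- The unit element of `A` as an element of `Idem A`. -/
def Idem.unit (k : Type*) [Field k] [CharP k 2] (A : Type*) [CommRing A] [Algebra k A] :
    Idem k A :=
  ⟨1, IsIdempotentElem.one⟩

/-- The quotient `Idem(A)/⟨1⟩`. -/
abbrev IdemQuot (k : Type*) [Field k] [CharP k 2] (A : Type*) [CommRing A] [Algebra k A] : Type _ :=
  Idem k A ⧸ AddSubgroup.zmultiples (Idem.unit k A)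

end QuadPencil

end

open QuadPencil

/-! Write `w_i` for the coefficients of the radical map `Ω`. As `Ω` spans the radical of the polar
pencil, comparing coefficients in `(b₀ + T b₁)Ω(1,T) = 0` gives `b₀(·,w₀) = 0`, `b₀(·,w_{i+1}) =
b₁(·,w_i)` and `b₁(·,w_m) = 0`. Hence the `w_i` are mutually orthogonal for both polar forms, and
expanding `Δ` yields `a_{2i} = q₀(w_i)` and `a_{2i+1} = q₁(w_i)`.

Regularity enters through one fact: `Ω` vanishes at no geometric point `(1,τ)`. Otherwise the polar
form of `q₀ + τq₁` would have a radical of dimension at least three; there the form is the square of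
a linear function, and a zero of `q₁` on the kernel of that function is a singular point of the base
locus (`exists_singular_point`). The point at infinity is covered by `a_n = q₁(w_m) ≠ 0`. So the
coordinates of `Ω` generate the unit ideal, and every solution of degree at most `m` of the kernel
equations is a scalar multiple of `Ω` (`exists_eq_smul_radVec`). A dimension count then makes the
`w_i` independent, and a dual frame, corrected by an explicit solution of a linear system, completes
them to a Kronecker basis (`exists_isKroneckerBasis`).

An automorphism `g` of the pair maps `Ω` to a multiple `cΩ`, and `q₁(w_m) ≠ 0` forces `c² = 1`, so
`c = 1`. Thus `g` fixes every `w_i`, and orthogonality puts each `g v_i - v_i` into the span of the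
`w_j`. Invariance of the polar forms says that the resulting matrix is a Hankel matrix `(s_{i+j})`;
invariance of `q₁` and `q₀` on `v_i` gives the equations `s_r = ∑_i a_{2i+1-r} s_i²` for `r = 2i`
and `r = 2i+1`, that is for `r < 2m` (`exists_eq_hankelEquiv`, `map_add_hankelMap`).

On the algebra side, `d_i² = ∑_r a_{2i+1-r} d_r` in characteristic two (`tail_sq`). So `∑ s_i d_i`
is idempotent exactly when the same equations hold for all `r ≤ 2m`. The extra unknown `s_{2m}` is
the coefficient of `d_{2m} = a_n`, a constant that does not occur in `g`. The extra equation is an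
Artin–Schreier equation over the base field; it has a root in `A`, and `dim A` is odd, so it has a
root in the base field (`exists_artinSchreier_root`). This gives surjectivity, and the kernel
consists of the idempotent constants, which form `⟨1⟩`. The order follows from counting the clopen
subsets of `Spec A`. -/

noncomputable section

namespace QuadPencil

/-! ### Hafnians, that is Pfaffians in characteristic two -/

section Hafnian

variable {R : Type*} [CommRing R] {ι : Type*} [LinearOrder ι]

/-- The hafnian of the principal submatrix of `M` on the finite set `S`, by expansion along the
row of the least element. In characteristic two it is the Pfaffian. -/
def haf (M : ι → ι → R) (S : Finset ι) : R :=
  if h : S.Nonempty then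
    ∑ j ∈ (S.erase (S.min' h)).attach, M (S.min' h) j * haf M ((S.erase (S.min' h)).erase j)
  else 1
termination_by S.card
decreasing_by
  exact (Finset.card_le_card (Finset.erase_subset _ _)).trans_lt
    (Finset.card_erase_lt_of_mem (S.min'_mem h))

theorem haf_empty (M : ι → ι → R) : haf M ∅ = 1 := by
  rw [haf]; simp

theorem haf_eq_sum_min (M : ι → ι → R) {S : Finset ι} {a : ι} (ha : a ∈ S)
    (hmin : ∀ b ∈ S, a ≤ b) :
    haf M S = ∑ j ∈ S.erase a, M a j * haf M ((S.erase a).erase j) := by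
  have hne : S.Nonempty := ⟨a, ha⟩
  have hm : S.min' hne = a :=
    le_antisymm (Finset.min'_le _ _ ha) (Finset.le_min' _ _ _ hmin)
  rw [haf, dif_pos hne, hm]
  exact Finset.sum_attach (S.erase a) (fun j => M a j * haf M ((S.erase a).erase j))

/-- Expansion of the hafnian along an arbitrary row. -/
theorem haf_eq_sum (M : ι → ι → R) (hM : ∀ i j, M i j = M j i) (S : Finset ι) :
    ∀ i ∈ S, haf M S = ∑ j ∈ S.erase i, M i j * haf M ((S.erase i).erase j) := by
  induction S using Finset.strongInduction with
  | H S ih =>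
    intro i hi
    have hne : S.Nonempty := ⟨i, hi⟩
    set a := S.min' hne with ha
    have haS : a ∈ S := S.min'_mem hne
    have hmin : ∀ b ∈ S, a ≤ b := fun b hb => S.min'_le b hb
    rw [haf_eq_sum_min M haS hmin]
    by_cases hia : i = a
    · rw [hia]
    have hiS : i ∈ S.erase a := Finset.mem_erase.2 ⟨hia, hi⟩
    have haS' : a ∈ S.erase i := Finset.mem_erase.2 ⟨Ne.symm hia, haS⟩
    rw [← Finset.add_sum_erase _ _ hiS, ← Finset.add_sum_erase _ _ haS', hM a i,
      Finset.erase_right_comm (a := a) (b := i)]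
    congr 1
    -- Apart from the common term pairing `a` with `i`, both expansions are expanded once more,
    -- along `i` and along `a` respectively. They become the same sum over ordered pairs `j ≠ l`;
    -- writing the diagonal terms as zero lets both indices run over one fixed set, so that the sums
    -- can be interchanged.
    have h1 : ∀ j ∈ (S.erase i).erase a, M a j * haf M ((S.erase a).erase j) =
        ∑ l ∈ (S.erase i).erase a, if l = j then 0 else
          M a j * (M i l * haf M ((((S.erase i).erase a).erase j).erase l)) := by
      intro j hj
      simp only [Finset.mem_erase] at hj
      rw [ih ((S.erase a).erase j)
        (((Finset.erase_subset _ _)).trans_ssubset (Finset.erase_ssubset haS)) i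
        (by simp [hia, hi, Ne.symm hj.2.1]), Finset.mul_sum]
      have hset : ((S.erase a).erase j).erase i = ((S.erase i).erase a).erase j := by
        ext x; simp only [Finset.mem_erase]; tauto
      rw [hset]
      have : ∀ T : Finset ι, ∀ g : ι → R, (∑ l ∈ T, if l = j then 0 else g l) =
          ∑ l ∈ T.erase j, g l := by
        intro T g
        rw [← Finset.filter_ne', Finset.sum_filter]
        exact Finset.sum_congr rfl fun l _ => by by_cases h : l = j <;> simp [h]
      rw [this]
    have h2 : ∀ l ∈ (S.erase i).erase a, M i l * haf M ((S.erase i).erase l) =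
        ∑ j ∈ (S.erase i).erase a, if l = j then 0 else
          M a j * (M i l * haf M ((((S.erase i).erase a).erase j).erase l)) := by
      intro l hl
      simp only [Finset.mem_erase] at hl
      rw [haf_eq_sum_min M (S := (S.erase i).erase l) (a := a)
        (by simp [haS, Ne.symm hl.1, Ne.symm hia])
        (fun b hb => hmin b (Finset.mem_of_mem_erase (Finset.mem_of_mem_erase hb))),
        Finset.mul_sum]
      have hset : ((S.erase i).erase l).erase a = ((S.erase i).erase a).erase l :=
        Finset.erase_right_comm
      rw [hset, ← Finset.filter_ne', Finset.sum_filter]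
      refine Finset.sum_congr rfl fun j _ => ?_
      by_cases h : l = j
      · simp [h]
      · rw [if_pos (Ne.symm h), if_neg h, Finset.filter_ne',
          Finset.erase_right_comm (a := l) (b := j)]
        ring
    rw [Finset.sum_congr rfl h1, Finset.sum_congr rfl h2, Finset.sum_comm]

theorem haf_eq_zero_of_odd (M : ι → ι → R) (S : Finset ι) (hS : Odd S.card) :
    haf M S = 0 := by
  induction S using Finset.strongInduction with
  | H S ih =>
    have hne : S.Nonempty := by
      rw [← Finset.card_pos]; exact hS.pos
    rw [haf_eq_sum_min M (S.min'_mem hne) (fun b hb => S.min'_le b hb)]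
    refine Finset.sum_eq_zero fun j hj => ?_
    rw [ih _ (((Finset.erase_subset _ _)).trans_ssubset
      (Finset.erase_ssubset (S.min'_mem hne))), mul_zero]
    have h1 := Finset.card_erase_add_one hj
    have h2 := Finset.card_erase_add_one (S.min'_mem hne)
    rw [← h2, ← h1] at hS
    simpa [parity_simps] using hS

theorem map_haf {R' : Type*} [CommRing R'] (φ : R →+* R') (M : ι → ι → R) (S : Finset ι) :
    haf (fun i j => φ (M i j)) S = φ (haf M S) := by
  induction S using Finset.strongInduction with
  | H S ih =>
    by_cases hne : S.Nonempty
    · have h1 := S.min'_mem hne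
      have h2 : ∀ b ∈ S, S.min' hne ≤ b := fun b hb => S.min'_le b hb
      rw [haf_eq_sum_min _ h1 h2, haf_eq_sum_min _ h1 h2, map_sum]
      refine Finset.sum_congr rfl fun j _ => ?_
      rw [map_mul, ih _ (((Finset.erase_subset _ _)).trans_ssubset (Finset.erase_ssubset h1))]
    · rw [Finset.not_nonempty_iff_eq_empty] at hne
      rw [hne, haf_empty, haf_empty, map_one]

-- The terms at `(i, j)` and `(j, i)` cancel in characteristic two.
omit [LinearOrder ι] in
theorem sum_mul_swap_eq_zero [CharP R 2] (S : Finset ι) (g : ι → ι → R)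
    (hg : ∀ i ∈ S, ∀ j ∈ S, g i j = g j i) (hd : ∀ i ∈ S, g i i = 0) :
    ∑ i ∈ S, ∑ j ∈ S, g i j = 0 := by
  rw [← Finset.sum_product']
  refine Finset.sum_involution (fun p _ => (p.2, p.1)) ?_ ?_ ?_ ?_
  · rintro ⟨i, j⟩ h
    rw [Finset.mem_product] at h
    simp only
    rw [hg i h.1 j h.2, CharTwo.add_self_eq_zero]
  · rintro ⟨i, j⟩ h hne heq
    rw [Finset.mem_product] at h
    simp only [Prod.mk.injEq] at heq
    rw [heq.1] at hne
    exact hne (hd i h.1)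
  · rintro ⟨i, j⟩ h
    simpa [and_comm] using h
  · rintro ⟨i, j⟩ _
    rfl

variable [CharP R 2] (M : ι → ι → R) (hM : ∀ i j, M i j = M j i) (hd : ∀ i, M i i = 0)
include hM hd

/-- The vector of sub-Pfaffians is annihilated by the matrix. -/
theorem sum_mul_haf_erase {S : Finset ι} {i : ι} (hi : i ∈ S) :
    ∑ l ∈ S, M i l * haf M (S.erase l) = 0 := by
  rw [← Finset.add_sum_erase _ _ hi, hd, zero_mul, zero_add]
  have h1 : ∀ l ∈ S.erase i, M i l * haf M (S.erase l) =
      ∑ j ∈ S.erase i, if j = l then 0 else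
        M i l * M i j * haf M (((S.erase i).erase l).erase j) := by
    intro l hl
    rw [Finset.mem_erase] at hl
    rw [haf_eq_sum M hM (S.erase l) i (by simp [hi, Ne.symm hl.1]), Finset.mul_sum,
      Finset.erase_right_comm, ← Finset.filter_ne', Finset.sum_filter]
    refine Finset.sum_congr rfl fun j _ => ?_
    by_cases h : j = l
    · simp [h]
    · rw [if_pos h, if_neg h]; ring
  rw [Finset.sum_congr rfl h1]
  refine sum_mul_swap_eq_zero _ _ (fun a _ b _ => ?_) (fun a _ => by simp)
  by_cases h : a = b
  · simp [h]
  · rw [if_neg h, if_neg (Ne.symm h), Finset.erase_right_comm (a := a) (b := b), mul_comm (M i a)]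

/-- Cramer's rule for alternating matrices: a vector killed by the principal submatrix on `S` is
killed by its hafnian. -/
theorem haf_mul_eq_zero {S : Finset ι} (z : ι → R)
    (hz : ∀ i ∈ S, ∑ l ∈ S, M i l * z l = 0) {i : ι} (hi : i ∈ S) : haf M S * z i = 0 := by
  -- The hafnians of `S` without two indices serve as the `i`-th row of an adjugate: combining the
  -- equations with these weights leaves `haf M S` in front of `z i`, while the coefficients of the
  -- other `z l` vanish by `sum_mul_haf_erase`.
  have key : ∑ j ∈ S.erase i, haf M ((S.erase i).erase j) * ∑ l ∈ S, M j l * z l = 0 :=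
    Finset.sum_eq_zero fun j hj => by rw [hz j (Finset.mem_of_mem_erase hj), mul_zero]
  have h2 : ∑ j ∈ S.erase i, haf M ((S.erase i).erase j) * ∑ l ∈ S, M j l * z l =
      ∑ l ∈ S, (∑ j ∈ S.erase i, M l j * haf M ((S.erase i).erase j)) * z l := by
    simp_rw [Finset.mul_sum, Finset.sum_mul]
    rw [Finset.sum_comm]
    refine Finset.sum_congr rfl fun l _ => Finset.sum_congr rfl fun j _ => ?_
    rw [hM l j]; ring
  rw [h2, ← Finset.add_sum_erase _ _ hi, ← haf_eq_sum M hM S i hi] at key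
  rw [Finset.sum_eq_zero, add_zero] at key
  · exact key
  · intro l hl
    rw [sum_mul_haf_erase M hM hd hl, zero_mul]

/-- A vector in the kernel of an alternating matrix of odd size is proportional to the vector of
sub-Pfaffians. -/
theorem haf_erase_mul_eq [IsDomain R] {T : Finset ι} (y : ι → R)
    (hy : ∀ i ∈ T, ∑ l ∈ T, M i l * y l = 0) {i j : ι} (hi : i ∈ T) (hj : j ∈ T) :
    haf M (T.erase j) * y i = haf M (T.erase i) * y j := by
  -- If one of the two hafnians is nonzero, say that of `T.erase j`, the combination of `y` with the
  -- sub-Pfaffian vector that vanishes at `j` is killed by the principal submatrix on `T.erase j`,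
  -- hence is zero by Cramer's rule.
  by_cases h0 : haf M (T.erase j) = 0
  · by_cases h1 : haf M (T.erase i) = 0
    · rw [h0, h1, zero_mul, zero_mul]
    have := haf_mul_eq_zero M hM hd (S := T.erase i)
      (fun l => haf M (T.erase l) * y i - haf M (T.erase i) * y l) (fun a ha => ?_) (i := j)
    · by_cases hij : j = i
      · rw [hij]
      · have := this (Finset.mem_erase.2 ⟨hij, hj⟩)
        simpa [h1, sub_eq_zero] using this
    · have e : ∑ l ∈ T, M a l * (haf M (T.erase l) * y i - haf M (T.erase i) * y l) = 0 := by
        have ha' := Finset.mem_of_mem_erase ha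
        have e1 := sum_mul_haf_erase M hM hd ha'
        have e2 := hy a ha'
        calc _ = (∑ l ∈ T, M a l * haf M (T.erase l)) * y i
              - haf M (T.erase i) * ∑ l ∈ T, M a l * y l := by
              rw [Finset.sum_mul, Finset.mul_sum, ← Finset.sum_sub_distrib]
              exact Finset.sum_congr rfl fun _ _ => by ring
          _ = 0 := by rw [e1, e2]; ring
      rw [← Finset.add_sum_erase _ _ hi] at e
      simpa using e
  · by_cases hij : i = j
    · rw [hij]
    have := haf_mul_eq_zero M hM hd (S := T.erase j)
      (fun l => haf M (T.erase j) * y l - haf M (T.erase l) * y j) (fun a ha => ?_) (i := i)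
      (Finset.mem_erase.2 ⟨hij, hi⟩)
    · simpa [h0, sub_eq_zero] using this
    · have e : ∑ l ∈ T, M a l * (haf M (T.erase j) * y l - haf M (T.erase l) * y j) = 0 := by
        have ha' := Finset.mem_of_mem_erase ha
        have e1 := sum_mul_haf_erase M hM hd ha'
        have e2 := hy a ha'
        calc _ = haf M (T.erase j) * (∑ l ∈ T, M a l * y l)
              - (∑ l ∈ T, M a l * haf M (T.erase l)) * y j := by
              rw [Finset.sum_mul, Finset.mul_sum, ← Finset.sum_sub_distrib]
              exact Finset.sum_congr rfl fun _ _ => by ring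
          _ = 0 := by rw [e1, e2]; ring
      rw [← Finset.add_sum_erase _ _ hj] at e
      simpa using e

-- The recursion on relabelled matrices and the recursion on index sets agree because a strictly
-- increasing `f` sends the first row to the least index; the signs disappear in characteristic two.
-- Index sets make it possible to compare overlapping minors of one matrix.
omit hM hd in
theorem pfaffian_eq_haf (m : ℕ) (f : Fin (2 * m) → ι) (hf : StrictMono f)
    (N : Matrix (Fin (2 * m)) (Fin (2 * m)) R) (hN : ∀ i j, N i j = M (f i) (f j)) :
    pfaffian m N = haf M (Finset.univ.image f) := by
  induction m with
  | zero =>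
    have : (Finset.univ : Finset (Fin (2 * 0))) = ∅ := rfl
    rw [this, Finset.image_empty, haf_empty]
    rfl
  | succ m ih =>
    have h0 : f 0 ∈ Finset.univ.image f := Finset.mem_image_of_mem _ (Finset.mem_univ _)
    have himg : (Finset.univ.image f).erase (f 0) =
        Finset.univ.image (fun i : Fin (2 * m + 1) => f i.succ) := by
      ext x
      simp only [Finset.mem_erase, Finset.mem_image, Finset.mem_univ, true_and]
      constructor
      · rintro ⟨hx, i, rfl⟩
        obtain ⟨j, rfl⟩ := Fin.exists_succ_eq.2 (fun h : i = 0 => hx (by rw [h]))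
        exact ⟨j, rfl⟩
      · rintro ⟨i, rfl⟩
        exact ⟨fun h => Fin.succ_ne_zero i (hf.injective h), i.succ, rfl⟩
    have hsum : ∀ g : ι → R, ∑ x ∈ Finset.univ.image (fun i : Fin (2 * m + 1) => f i.succ), g x =
        ∑ i : Fin (2 * m + 1), g (f i.succ) := fun g =>
      Finset.sum_image (fun a _ b _ h => Fin.succ_injective _ (hf.injective h))
    have hexp : pfaffian (m + 1) N = ∑ j : Fin (2 * m + 1), (-1) ^ (j : ℕ) * N 0 j.succ *
        pfaffian m (N.submatrix (fun i => (j.succAbove i).succ)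
          (fun i => (j.succAbove i).succ)) := rfl
    rw [haf_eq_sum_min M h0 (by
      simp only [Finset.mem_image, Finset.mem_univ, true_and]
      rintro b ⟨i, rfl⟩
      exact hf.monotone (Fin.zero_le i)), himg, hsum, hexp]
    refine Finset.sum_congr rfl fun j _ => ?_
    have hone : (-1 : R) = 1 := CharTwo.neg_eq 1
    rw [hone, one_pow, one_mul, hN]
    congr 1
    refine (ih (fun i => f (j.succAbove i).succ) (fun a b h => hf
      (Fin.succ_lt_succ_iff.2 (Fin.strictMono_succAbove j h))) _ (fun _ _ => hN _ _)).trans ?_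
    · congr 1
      ext x
      simp only [Finset.mem_erase, Finset.mem_image, Finset.mem_univ, true_and]
      constructor
      · rintro ⟨i, rfl⟩
        exact ⟨fun h => Fin.succAbove_ne j i (Fin.succ_injective _ (hf.injective h)), _, rfl⟩
      · rintro ⟨hx, i, rfl⟩
        obtain ⟨l, rfl⟩ := Fin.exists_succAbove_eq (fun h : i = j => hx (by rw [h]))
        exact ⟨l, rfl⟩

end Hafnian

end QuadPencil

end

/-! ### Kernels of alternating matrices with vanishing sub-Pfaffians -/

noncomputable section

namespace QuadPencil

/-- An alternating matrix of odd size over a field all of whose sub-Pfaffians vanish has at least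
three explicit independent kernel vectors. -/
theorem exists_kernel_vectors {K : Type*} [Field K] [CharP K 2] {m : ℕ}
    (M : Fin (2 * m + 1) → Fin (2 * m + 1) → K) (hM : ∀ i j, M i j = M j i) (hd : ∀ i, M i i = 0)
    (h0 : ∀ j, haf M (Finset.univ.erase j) = 0) :
    ∃ (S : Finset (Fin (2 * m + 1))) (z : Fin (2 * m + 1) → Fin (2 * m + 1) → K) (c : K),
      c ≠ 0 ∧ 3 ≤ (Finset.univ \ S).card ∧
      (∀ a ∉ S, ∀ i, ∑ l, M i l * z a l = 0) ∧
      (∀ a ∉ S, z a a = c) ∧ (∀ a ∉ S, ∀ b ∉ S, a ≠ b → z a b = 0) := by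
  classical
  -- `S` is a principal index set of largest size with nonzero hafnian.
  obtain ⟨S, hS, hmax⟩ := Finset.exists_max_image
    (Finset.univ.filter fun S : Finset (Fin (2 * m + 1)) => haf M S ≠ 0) Finset.card
    ⟨∅, by simp [haf_empty]⟩
  have hS' : haf M S ≠ 0 := by simpa using hS
  have hmax' : ∀ T : Finset (Fin (2 * m + 1)), S.card < T.card → haf M T = 0 := by
    intro T hT
    by_contra hne
    exact absurd (hmax T (by simpa using hne)) (not_le.2 hT)
  -- The vector attached to `a ∉ S` is the vector of sub-Pfaffians of the odd principal submatrix on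
  -- `insert a S`, extended by zero.
  refine ⟨S, fun a l => if l ∈ insert a S then haf M ((insert a S).erase l) else 0, haf M S,
    hS', ?_, ?_, ?_, ?_⟩
  -- `S` has even size, so its complement has odd size; size one is excluded by `h0`.
  · have heven : ¬ Odd S.card := fun h => hS' (haf_eq_zero_of_odd M S h)
    have hc := Finset.card_sdiff_add_card_eq_card (Finset.subset_univ S)
    rw [Finset.card_univ, Fintype.card_fin] at hc
    rw [Nat.not_odd_iff_even] at heven
    by_contra hlt
    have h1 : (Finset.univ \ S).card = 1 := by
      obtain ⟨r, hr⟩ := heven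
      omega
    obtain ⟨j, hj⟩ := Finset.card_eq_one.1 h1
    apply hS'
    have : S = Finset.univ.erase j := by
      rw [Finset.erase_eq, ← hj]; simp
    rw [this]
    exact h0 j
  · intro a ha i
    have hsum : ∀ g : Fin (2 * m + 1) → K,
        ∑ l, M i l * (if l ∈ insert a S then g l else 0) = ∑ l ∈ insert a S, M i l * g l := by
      intro g
      simp_rw [mul_ite, mul_zero]
      rw [← Finset.sum_filter]
      congr 1
      ext x; simp
    rw [hsum (fun l => haf M ((insert a S).erase l))]
    by_cases hi : i ∈ insert a S
    · exact sum_mul_haf_erase M hM hd hi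
    -- For a row outside `insert a S`, the sum is the expansion of a hafnian of size `|S| + 2`,
    -- which vanishes by maximality.
    · have h2 := haf_eq_sum M hM (insert i (insert a S)) i (Finset.mem_insert_self _ _)
      rw [Finset.erase_insert hi] at h2
      rw [← h2]
      apply hmax'
      rw [Finset.card_insert_of_notMem hi, Finset.card_insert_of_notMem ha]
      omega
  · intro a ha
    simp [Finset.erase_insert ha]
  · intro a ha b hb hab
    simp [hb, Ne.symm hab]

/-! ### Scalar extension of quadratic forms -/

section FormPoly

variable {k : Type*} [Field k] {E : Type*} [AddCommGroup E] [Module k E] {m : ℕ}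
  (e : Module.Basis (Fin (2 * m + 1)) k E) (q : QuadraticForm k E)
  {A : Type*} [CommRing A] [Algebra k A]

/-- The scalar extension of the polar form of `q`, in the coordinates of the basis `e`. -/
def polarExt (x y : Fin (2 * m + 1) → A) : A :=
  ∑ i, ∑ j, algebraMap k A (QuadraticMap.polar q (e i) (e j)) * x i * y j

theorem toBilin_add_swap (i j : Fin (2 * m + 1)) :
    q.toBilin e (e i) (e j) + q.toBilin e (e j) (e i) = QuadraticMap.polar q (e i) (e j) := by
  rw [QuadraticMap.toBilin_apply, QuadraticMap.toBilin_apply]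
  rcases lt_trichotomy i j with h | h | h
  · simp [h, h.ne, h.ne', not_lt_of_gt h]
  · subst h
    rw [if_pos rfl, QuadraticMap.polar_self]
    simp [two_mul]
  · rw [if_neg h.ne', if_neg (not_lt_of_gt h), if_neg h.ne, if_pos h, QuadraticMap.polar_comm]
    simp

/-- The triangular bilinear form `q.toBilin e` absorbs the squares and the mixed terms into one
double sum, which makes additivity, scaling and derivatives formal computations. -/
theorem formPoly_eq : formPoly e q = ∑ i, ∑ j, MvPolynomial.C (q.toBilin e (e i) (e j)) *
    MvPolynomial.X i * MvPolynomial.X j := by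
  rw [formPoly, ← Finset.sum_add_distrib]
  refine Finset.sum_congr rfl fun i _ => ?_
  have h1 : ∀ j : Fin (2 * m + 1), MvPolynomial.C (q.toBilin e (e i) (e j)) *
      MvPolynomial.X i * MvPolynomial.X j =
      (if i = j then MvPolynomial.C (q (e i)) * MvPolynomial.X i ^ 2 else 0) +
      (if i < j then MvPolynomial.C (QuadraticMap.polar q (e i) (e j)) * MvPolynomial.X i *
        MvPolynomial.X j else 0) := by
    intro j
    rw [QuadraticMap.toBilin_apply]
    rcases lt_trichotomy i j with h | h | h
    · simp [h, h.ne]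
    · subst h; simp; ring
    · simp [h.ne', not_lt_of_gt h]
  rw [Finset.sum_congr rfl fun j _ => h1 j, Finset.sum_add_distrib, Finset.sum_ite_eq,
    if_pos (Finset.mem_univ _), ← Finset.sum_filter]
  congr 2
  ext j; simp

theorem aeval_formPoly (x : Fin (2 * m + 1) → A) : MvPolynomial.aeval x (formPoly e q) =
    ∑ i, ∑ j, algebraMap k A (q.toBilin e (e i) (e j)) * x i * x j := by
  rw [formPoly_eq]
  simp [map_sum]

theorem aeval_formPoly_add (x y : Fin (2 * m + 1) → A) :
    MvPolynomial.aeval (x + y) (formPoly e q) = MvPolynomial.aeval x (formPoly e q) +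
      MvPolynomial.aeval y (formPoly e q) + polarExt e q x y := by
  have h : polarExt e q x y =
      (∑ i, ∑ j, algebraMap k A (q.toBilin e (e i) (e j)) * x i * y j) +
      ∑ i, ∑ j, algebraMap k A (q.toBilin e (e i) (e j)) * y i * x j := by
    rw [Finset.sum_comm (f := fun i j => algebraMap k A (q.toBilin e (e i) (e j)) * y i * x j),
      polarExt, ← Finset.sum_add_distrib]
    refine Finset.sum_congr rfl fun i _ => ?_
    rw [← Finset.sum_add_distrib]
    refine Finset.sum_congr rfl fun j _ => ?_
    rw [← toBilin_add_swap, map_add]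
    ring
  rw [h]
  simp only [aeval_formPoly, ← Finset.sum_add_distrib]
  refine Finset.sum_congr rfl fun i _ => Finset.sum_congr rfl fun j _ => ?_
  simp only [Pi.add_apply]
  ring

theorem aeval_formPoly_smul (a : A) (x : Fin (2 * m + 1) → A) :
    MvPolynomial.aeval (a • x) (formPoly e q) = a ^ 2 * MvPolynomial.aeval x (formPoly e q) := by
  simp only [aeval_formPoly, Finset.mul_sum]
  refine Finset.sum_congr rfl fun i _ => Finset.sum_congr rfl fun j _ => ?_
  simp only [Pi.smul_apply, smul_eq_mul]
  ring

theorem bilin_eq_sum (B : LinearMap.BilinForm k E) (v w : E) :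
    B v w = ∑ i, ∑ j, B (e i) (e j) * e.repr v i * e.repr w j := by
  conv_lhs => rw [← e.sum_repr v, ← e.sum_repr w]
  simp only [map_sum, LinearMap.sum_apply, map_smul, LinearMap.smul_apply, smul_eq_mul,
    Finset.mul_sum]
  rw [Finset.sum_comm]
  exact Finset.sum_congr rfl fun i _ => Finset.sum_congr rfl fun j _ => by ring

theorem aeval_formPoly_repr (v : E) :
    MvPolynomial.aeval (fun i => algebraMap k A (e.repr v i)) (formPoly e q) =
      algebraMap k A (q v) := by
  rw [aeval_formPoly]
  conv_rhs => rw [← QuadraticMap.toQuadraticMap_toBilin q e]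
  rw [LinearMap.BilinMap.toQuadraticMap_apply, bilin_eq_sum e]
  simp [map_sum]

theorem polarExt_repr (v w : E) :
    polarExt e q (fun i => algebraMap k A (e.repr v i)) (fun i => algebraMap k A (e.repr w i)) =
      algebraMap k A (QuadraticMap.polar q v w) := by
  have := bilin_eq_sum e (QuadraticMap.polarBilin q) v w
  simp only [QuadraticMap.polarBilin_apply_apply] at this
  rw [this, polarExt]
  simp [map_sum]

theorem polarExt_smul_left (a : A) (x y : Fin (2 * m + 1) → A) :
    polarExt e q (a • x) y = a * polarExt e q x y := by
  simp only [polarExt, Finset.mul_sum]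
  refine Finset.sum_congr rfl fun i _ => Finset.sum_congr rfl fun j _ => ?_
  simp only [Pi.smul_apply, smul_eq_mul]
  ring

theorem polarExt_smul_right (a : A) (x y : Fin (2 * m + 1) → A) :
    polarExt e q x (a • y) = a * polarExt e q x y := by
  simp only [polarExt, Finset.mul_sum]
  refine Finset.sum_congr rfl fun i _ => Finset.sum_congr rfl fun j _ => ?_
  simp only [Pi.smul_apply, smul_eq_mul]
  ring

theorem polarExt_sum_right {ι : Type*} (s : Finset ι) (x : Fin (2 * m + 1) → A)
    (y : ι → Fin (2 * m + 1) → A) :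
    polarExt e q x (∑ l ∈ s, y l) = ∑ l ∈ s, polarExt e q x (y l) := by
  simp only [polarExt, Finset.sum_apply, Finset.mul_sum]
  symm
  rw [Finset.sum_comm]
  exact Finset.sum_congr rfl fun i _ => Finset.sum_comm

theorem aeval_pderiv_formPoly (c : Fin (2 * m + 1) → A) (l : Fin (2 * m + 1)) :
    MvPolynomial.aeval c (MvPolynomial.pderiv l (formPoly e q)) =
      ∑ j, algebraMap k A (QuadraticMap.polar q (e l) (e j)) * c j := by
  have h1 : ∀ i j : Fin (2 * m + 1), MvPolynomial.aeval c (MvPolynomial.pderiv l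
      (MvPolynomial.C (q.toBilin e (e i) (e j)) * MvPolynomial.X i * MvPolynomial.X j)) =
      (if i = l then algebraMap k A (q.toBilin e (e i) (e j)) * c j else 0) +
      (if j = l then algebraMap k A (q.toBilin e (e i) (e j)) * c i else 0) := by
    intro i j
    simp only [MvPolynomial.pderiv_mul, MvPolynomial.pderiv_C, MvPolynomial.pderiv_X, Pi.single_apply]
    by_cases hi : i = l <;> by_cases hj : j = l <;> simp [hi, hj]
  rw [formPoly_eq]
  simp only [map_sum, h1, Finset.sum_add_distrib]
  rw [Finset.sum_comm]
  simp only [Finset.sum_ite_eq', Finset.mem_univ, if_true]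
  rw [← Finset.sum_add_distrib]
  refine Finset.sum_congr rfl fun j _ => ?_
  rw [← toBilin_add_swap, map_add, add_mul]

end FormPoly

end QuadPencil

end

/-! ### Nonvanishing of the radical map for a regular pair -/

noncomputable section

namespace QuadPencil

/-- A quadratic function on a plane over an algebraically closed field has a nontrivial zero. -/
theorem exists_isotropic {K V : Type*} [Field K] [IsAlgClosed K] [AddCommGroup V] [Module K V]
    (Q : V → K) (B : V → V → K) (hadd : ∀ x y, Q (x + y) = Q x + Q y + B x y)
    (hsmul : ∀ (a : K) x, Q (a • x) = a ^ 2 * Q x) (hB : ∀ (a : K) x y, B (a • x) y = a * B x y)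
    (hV : 1 < Module.finrank K V) : ∃ v, v ≠ 0 ∧ Q v = 0 := by
  have : Nontrivial V := Module.nontrivial_of_finrank_pos (R := K) (by omega)
  obtain ⟨x, hx⟩ := exists_ne (0 : V)
  obtain ⟨y, hy⟩ := exists_linearIndependent_pair_of_one_lt_finrank hV hx
  by_cases h0 : Q x = 0
  · exact ⟨x, hx, h0⟩
  -- The polynomial is `Q (s • x + y)` as a function of `s`, of degree two since `Q x ≠ 0`.
  obtain ⟨s, hs⟩ := IsAlgClosed.exists_root (C (Q x) * X ^ 2 + C (B x y) * X + C (Q y))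
    (by rw [degree_quadratic h0]; decide)
  refine ⟨s • x + y, ?_, ?_⟩
  · intro h
    rw [LinearIndependent.pair_iff] at hy
    have := hy s 1 (by simpa using h)
    exact one_ne_zero this.2
  · rw [hadd, hsmul, hB]
    simp only [IsRoot.def, eval_add, eval_mul, eval_C, eval_pow, eval_X] at hs
    linear_combination hs

variable {k : Type*} [Field k] {E : Type*} [AddCommGroup E] [Module k E] {m : ℕ}
  (e : Module.Basis (Fin (2 * m + 1)) k E) (q₀ q₁ : QuadraticForm k E)
  {A : Type*} [CommRing A] [Algebra k A]

/-- The polar matrix of `a q₀ + b q₁` with `a`, `b` in a `k`-algebra. -/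
def pencilMatrix (a b : A) (i j : Fin (2 * m + 1)) : A :=
  a * algebraMap k A (QuadraticMap.polar q₀ (e i) (e j)) +
    b * algebraMap k A (QuadraticMap.polar q₁ (e i) (e j))

theorem pencilMatrix_comm (a b : A) (i j : Fin (2 * m + 1)) :
    pencilMatrix e q₀ q₁ a b i j = pencilMatrix e q₀ q₁ a b j i := by
  simp only [pencilMatrix, QuadraticMap.polar_comm _ (e i)]

theorem sum_pencilMatrix_mul (a b : A) (i : Fin (2 * m + 1)) (y : Fin (2 * m + 1) → A) :
    ∑ j, pencilMatrix e q₀ q₁ a b i j * y j =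
      a * (∑ j, algebraMap k A (QuadraticMap.polar q₀ (e i) (e j)) * y j) +
      b * ∑ j, algebraMap k A (QuadraticMap.polar q₁ (e i) (e j)) * y j := by
  simp only [pencilMatrix, Finset.mul_sum, ← Finset.sum_add_distrib]
  exact Finset.sum_congr rfl fun j _ => by ring

section CharTwo

variable [CharP k 2]

omit m in
theorem polar_self_eq_zero (q : QuadraticForm k E) (x : E) : QuadraticMap.polar q x x = 0 := by
  rw [QuadraticMap.polar_self, two_nsmul, CharTwo.add_self_eq_zero]

theorem pencilMatrix_self (a b : A) (i : Fin (2 * m + 1)) :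
    pencilMatrix e q₀ q₁ a b i i = 0 := by
  rw [pencilMatrix, polar_self_eq_zero, polar_self_eq_zero, map_zero, mul_zero, mul_zero, add_zero]

theorem radicalMap_eq_haf (j : Fin (2 * m + 1)) : radicalMap e q₀ q₁ j =
    haf (pencilMatrix e q₀ q₁ (MvPolynomial.X 0) (MvPolynomial.X 1)) (Finset.univ.erase j) := by
  refine (pfaffian_eq_haf
    (pencilMatrix e q₀ q₁ (MvPolynomial.X 0) (MvPolynomial.X 1)) m j.succAbove
    (Fin.strictMono_succAbove j) _ (fun _ _ => rfl)).trans ?_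
  congr 1
  ext x
  simp

/-- Hafnians commute with ring homomorphisms, so the kernel relation and Cramer's rule become
available for every specialization of `Ω`: over `k[X]`, at a geometric point, and at infinity. -/
theorem aeval_radicalMap [CharP A 2] (a b : A) (j : Fin (2 * m + 1)) :
    MvPolynomial.aeval ![a, b] (radicalMap e q₀ q₁ j) =
      haf (pencilMatrix e q₀ q₁ a b) (Finset.univ.erase j) := by
  rw [radicalMap_eq_haf]
  refine (map_haf (MvPolynomial.aeval ![a, b] : MvPolynomial (Fin 2) k →ₐ[k] A).toRingHom
    _ _).symm.trans ?_
  congr 1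
  funext i l
  simp [pencilMatrix]

/-- If `Ω` vanishes at `(1, τ)`, the base locus has a singular point. -/
theorem exists_singular_point {K : Type*} [Field K] [IsAlgClosed K] [CharP K 2] [Algebra k K]
    (τ : K) (hzero : ∀ j, MvPolynomial.aeval ![1, τ] (radicalMap e q₀ q₁ j) = 0) :
    ∃ c : Fin (2 * m + 1) → K, c ≠ 0 ∧ MvPolynomial.aeval c (formPoly e q₀) = 0 ∧
      MvPolynomial.aeval c (formPoly e q₁) = 0 ∧
      ∀ l, ∑ j, pencilMatrix e q₀ q₁ 1 τ l j * c j = 0 := by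
  simp only [aeval_radicalMap] at hzero
  obtain ⟨S, z, c, hc, hcard, hker, hdiag, hoff⟩ := exists_kernel_vectors
    (pencilMatrix e q₀ q₁ (1 : K) τ) (pencilMatrix_comm e q₀ q₁ _ _)
    (pencilMatrix_self e q₀ q₁ _ _) hzero
  obtain ⟨T, hT, hT3⟩ := Finset.exists_subset_card_eq hcard
  have hTS : ∀ a : T, (a : Fin (2 * m + 1)) ∉ S := fun a => by
    have := hT a.2
    simpa using this
  -- `F` parametrizes a three-dimensional subspace of the radical of the polar form of `q₀ + τ q₁`.
  let F : (T → K) →ₗ[K] (Fin (2 * m + 1) → K) := Fintype.linearCombination K (fun a : T => z a)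
  have hF : ∀ x, F x = ∑ a, x a • z a := fun x => rfl
  have hFinj : ∀ x, F x = 0 → x = 0 := by
    intro x hx
    funext a
    have h1 := congrFun hx a
    rw [hF, Finset.sum_apply, Finset.sum_eq_single a] at h1
    · simpa [hdiag _ (hTS a), hc] using h1
    · intro b _ hb
      simp [hoff _ (hTS b) _ (hTS a) (fun h => hb (Subtype.ext h))]
    · simp
  have hFker : ∀ x i, ∑ l, pencilMatrix e q₀ q₁ (1 : K) τ i l * F x l = 0 := by
    intro x i
    simp only [hF, Finset.sum_apply, Finset.mul_sum, Pi.smul_apply, smul_eq_mul]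
    rw [Finset.sum_comm]
    refine Finset.sum_eq_zero fun a _ => ?_
    calc _ = x a * ∑ l, pencilMatrix e q₀ q₁ (1 : K) τ i l * z a l := by
          rw [Finset.mul_sum]; exact Finset.sum_congr rfl fun _ _ => by ring
      _ = 0 := by rw [hker _ (hTS a), mul_zero]
  let Q₀ : (Fin (2 * m + 1) → K) → K := fun c => MvPolynomial.aeval c (formPoly e q₀)
  let Q₁ : (Fin (2 * m + 1) → K) → K := fun c => MvPolynomial.aeval c (formPoly e q₁)
  have hpol : ∀ x y, polarExt e q₀ x (F y) + τ * polarExt e q₁ x (F y) = 0 := by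
    intro x y
    calc _ = ∑ i, x i * ∑ l, pencilMatrix e q₀ q₁ (1 : K) τ i l * F y l := by
          simp only [sum_pencilMatrix_mul, polarExt, Finset.mul_sum, ← Finset.sum_add_distrib]
          exact Finset.sum_congr rfl fun _ _ => Finset.sum_congr rfl fun _ _ => by ring
      _ = 0 := Finset.sum_eq_zero fun i _ => by rw [hFker, mul_zero]
  have hadd : ∀ x y, Q₀ (F (x + y)) + τ * Q₁ (F (x + y)) =
      (Q₀ (F x) + τ * Q₁ (F x)) + (Q₀ (F y) + τ * Q₁ (F y)) := by
    intro x y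
    have := hpol (F x) y
    simp only [Q₀, Q₁, map_add, aeval_formPoly_add]
    linear_combination this
  have hsm : ∀ (a : K) x, Q₀ (F (a • x)) + τ * Q₁ (F (a • x)) =
      a ^ 2 * (Q₀ (F x) + τ * Q₁ (F x)) := by
    intro a x
    simp only [Q₀, Q₁, map_smul, aeval_formPoly_smul]
    ring
  have hsq : ∀ a b : K, a ^ 2 = b ^ 2 → a = b := by
    intro a b h
    have : (a + b) ^ 2 = 0 := by rw [CharTwo.add_sq, h, CharTwo.add_self_eq_zero]
    rw [← sub_eq_zero, CharTwo.sub_eq_add]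
    exact pow_eq_zero_iff (two_ne_zero) |>.1 this
  -- On the radical the form `q₀ + τ q₁` is additive and scales by squares. Square roots are unique
  -- in characteristic two, so its square root is a linear functional, with kernel of dimension at
  -- least two; `q₁` has a nontrivial zero there.
  choose r hr using fun a : K => IsAlgClosed.exists_pow_nat_eq a (n := 2) (by norm_num)
  let φ : (T → K) →ₗ[K] K :=
    { toFun := fun x => r (Q₀ (F x) + τ * Q₁ (F x))
      map_add' := fun x y => hsq _ _ (by rw [CharTwo.add_sq, hr, hr, hr, hadd])
      map_smul' := fun a x => hsq _ _ (by
        rw [smul_eq_mul, mul_pow, hr, hr, hsm]; rfl) }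
  have hφ : ∀ x, φ x = 0 → Q₀ (F x) + τ * Q₁ (F x) = 0 := by
    intro x hx
    have h1 : r (Q₀ (F x) + τ * Q₁ (F x)) = 0 := hx
    rw [← hr (Q₀ (F x) + τ * Q₁ (F x)), h1]
    ring
  have hrank : 1 < Module.finrank K (LinearMap.ker φ) := by
    have h1 := LinearMap.finrank_range_add_finrank_ker φ
    have h2 : Module.finrank K (LinearMap.range φ) ≤ 1 :=
      (Submodule.finrank_le _).trans (by rw [Module.finrank_self])
    rw [Module.finrank_fintype_fun_eq_card, Fintype.card_coe, hT3] at h1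
    omega
  obtain ⟨v, hv0, hv⟩ := exists_isotropic (V := LinearMap.ker φ) (fun x => Q₁ (F x))
    (fun x y => polarExt e q₁ (F x) (F y))
    (fun x y => by simp only [Q₁, Submodule.coe_add, map_add, aeval_formPoly_add])
    (fun a x => by simp only [Q₁, Submodule.coe_smul, map_smul, aeval_formPoly_smul])
    (fun a x y => by simp only [Submodule.coe_smul, map_smul, polarExt_smul_left]) hrank
  have h0 : Q₀ (F v) = 0 := by
    have := hφ v v.2
    simpa [show Q₁ (F v) = 0 from hv] using this
  have hne : F v ≠ 0 := fun h => hv0 (Subtype.ext (hFinj _ h))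
  exact ⟨F v, hne, h0, hv, hFker v⟩

/-- The partial derivatives of a quadratic form are given by its polar form, so a base point in the
radical of `b₀ + τ b₁` has Jacobian rows with the linear relation `(1, τ)`. -/
theorem exists_aeval_radicalMap_ne_zero (hreg : IsRegularPair e q₀ q₁) (τ : AlgebraicClosure k) :
    ∃ j, MvPolynomial.aeval ![1, τ] (radicalMap e q₀ q₁ j) ≠ 0 := by
  by_contra! hzero
  obtain ⟨c, hc, h0, h1, hker⟩ := exists_singular_point e q₀ q₁ τ hzero
  have hli := hreg.2 c hc h0 h1
  rw [LinearIndependent.pair_iff] at hli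
  refine one_ne_zero (hli 1 τ ?_).1
  funext l
  have := hker l
  rw [sum_pencilMatrix_mul] at this
  simpa [aeval_pderiv_formPoly] using this

end CharTwo

end QuadPencil

end

/-! ### Coefficients of the radical map and of the half-discriminant -/

noncomputable section

namespace QuadPencil

theorem isHomogeneous_pfaffian {σ R : Type*} [CommRing R] (m : ℕ)
    (N : Matrix (Fin (2 * m)) (Fin (2 * m)) (MvPolynomial σ R))
    (hN : ∀ i j, (N i j).IsHomogeneous 1) : (pfaffian m N).IsHomogeneous m := by
  induction m with
  | zero => exact MvPolynomial.isHomogeneous_one _ _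
  | succ m ih =>
    refine MvPolynomial.IsHomogeneous.sum _ _ _ fun j _ => ?_
    have h1 : ((-1 : MvPolynomial σ R) ^ (j : ℕ)).IsHomogeneous 0 := by
      have := (MvPolynomial.isHomogeneous_C σ ((-1 : R) ^ (j : ℕ)))
      simpa using this
    have h2 := ih (N.submatrix (fun i => (j.succAbove i).succ) (fun i => (j.succAbove i).succ))
      (fun _ _ => hN _ _)
    have h3 := (h1.mul (hN 0 j.succ)).mul h2
    convert h3 using 1
    omega

theorem aeval_binary_form {k A : Type*} [CommRing k] [CommRing A] [Algebra k A] {m : ℕ}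
    {φ : MvPolynomial (Fin 2) k} (hφ : φ.IsHomogeneous m) (a b : A) :
    MvPolynomial.aeval ![a, b] φ = ∑ i ∈ Finset.range (m + 1), algebraMap k A (MvPolynomial.coeff
      (Finsupp.single 0 (m - i) + Finsupp.single 1 i) φ) * (a ^ (m - i) * b ^ i) := by
  have h : φ = ∑ i ∈ Finset.range (m + 1), MvPolynomial.monomial
      (Finsupp.single 0 (m - i) + Finsupp.single 1 i) (MvPolynomial.coeff
      (Finsupp.single 0 (m - i) + Finsupp.single 1 i) φ) := by
    ext d
    rw [MvPolynomial.coeff_sum]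
    simp only [MvPolynomial.coeff_monomial]
    have hexp : ∀ i, (Finsupp.single 0 (m - i) + Finsupp.single 1 i : Fin 2 →₀ ℕ) = d ↔
        m - i = d 0 ∧ i = d 1 := by
      intro i
      constructor
      · rintro rfl; simp
      · rintro ⟨h0, h1⟩
        ext x
        fin_cases x
        · simpa using h0
        · simpa using h1
    have hdeg : d.degree = d 0 + d 1 := by
      rw [Finsupp.degree_eq_sum, Fin.sum_univ_two]
    by_cases hd : d 0 + d 1 = m
    · rw [Finset.sum_eq_single (d 1)]
      · have h1 : (Finsupp.single 0 (m - d 1) + Finsupp.single 1 (d 1) : Fin 2 →₀ ℕ) = d :=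
          (hexp _).2 ⟨by omega, rfl⟩
        rw [if_pos h1, h1]
      · intro i _ hi
        rw [if_neg]
        rw [hexp]
        exact fun h => hi h.2
      · intro h
        simp only [Finset.mem_range] at h
        omega
    · rw [hφ.coeff_eq_zero (by rw [hdeg]; exact hd)]
      symm
      refine Finset.sum_eq_zero fun i hi => ?_
      rw [if_neg]
      rw [hexp]
      rintro ⟨h0, h1⟩
      simp only [Finset.mem_range] at hi
      omega
  conv_lhs => rw [h]
  rw [map_sum]
  refine Finset.sum_congr rfl fun i _ => ?_
  rw [MvPolynomial.aeval_monomial, Finsupp.prod_fintype _ _ (by simp), Fin.prod_univ_two]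
  simp

variable {k : Type*} [Field k] {E : Type*} [AddCommGroup E] [Module k E] {m : ℕ}
  (e : Module.Basis (Fin (2 * m + 1)) k E) (q₀ q₁ : QuadraticForm k E)

theorem isHomogeneous_radicalMap (j : Fin (2 * m + 1)) :
    (radicalMap e q₀ q₁ j).IsHomogeneous m := by
  refine isHomogeneous_pfaffian m _ fun a b => ?_
  refine MvPolynomial.IsHomogeneous.add ?_ ?_
  · simpa using (MvPolynomial.isHomogeneous_X k (0 : Fin 2)).mul (MvPolynomial.isHomogeneous_C _
      (QuadraticMap.polar q₀ (e (j.succAbove a)) (e (j.succAbove b))))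
  · simpa using (MvPolynomial.isHomogeneous_X k (1 : Fin 2)).mul (MvPolynomial.isHomogeneous_C _
      (QuadraticMap.polar q₁ (e (j.succAbove a)) (e (j.succAbove b))))

/-- The coefficient of `X ^ s` of a vector of polynomials, as an element of `E`. -/
def coeffVec (Y : Fin (2 * m + 1) → k[X]) (s : ℕ) : E := ∑ j, (Y j).coeff s • e j

theorem repr_coeffVec (Y : Fin (2 * m + 1) → k[X]) (s : ℕ) (j : Fin (2 * m + 1)) :
    e.repr (coeffVec e Y s) j = (Y j).coeff s := by
  rw [coeffVec, e.repr_sum_self]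

theorem polar_coeffVec (q : QuadraticForm k E) (Y : Fin (2 * m + 1) → k[X]) (s : ℕ) (x : E) :
    QuadraticMap.polar q x (coeffVec e Y s) =
      ∑ j, QuadraticMap.polar q x (e j) * (Y j).coeff s := by
  rw [← QuadraticMap.polarBilin_apply_apply, coeffVec]
  simp only [map_sum, map_smul, smul_eq_mul, QuadraticMap.polarBilin_apply_apply]
  exact Finset.sum_congr rfl fun j _ => mul_comm _ _

/-- Comparison of coefficients in `(b₀ + X b₁) Y = 0`: this translates between polynomial kernel
vectors and chains of vectors of `E`. -/
theorem sum_pencilMatrix_mul_eq_zero_iff (Y : Fin (2 * m + 1) → k[X]) :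
    (∀ i, ∑ j, pencilMatrix e q₀ q₁ 1 X i j * Y j = 0) ↔
    (∀ x, QuadraticMap.polar q₀ x (coeffVec e Y 0) = 0) ∧
      ∀ s x, QuadraticMap.polar q₀ x (coeffVec e Y (s + 1)) +
        QuadraticMap.polar q₁ x (coeffVec e Y s) = 0 := by
  have hc : ∀ (q : QuadraticForm k E) i s,
      (∑ j, algebraMap k k[X] (QuadraticMap.polar q (e i) (e j)) * Y j).coeff s =
        QuadraticMap.polar q (e i) (coeffVec e Y s) := by
    intro q i s
    rw [polar_coeffVec, finsetSum_coeff]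
    exact Finset.sum_congr rfl fun j _ => by rw [algebraMap_eq, coeff_C_mul]
  constructor
  · intro h
    have h' : ∀ i s, _ := fun i s => congrArg (fun p => coeff p s) (h i)
    simp only [sum_pencilMatrix_mul, one_mul, coeff_add, hc, coeff_zero] at h'
    constructor
    · intro x
      have : (QuadraticMap.polarBilin q₀).flip (coeffVec e Y 0) = 0 :=
        e.ext fun i => by simpa [hc, QuadraticMap.polarBilin_apply_apply] using h' i 0
      exact LinearMap.congr_fun this x
    · intro s x
      have : (QuadraticMap.polarBilin q₀).flip (coeffVec e Y (s + 1)) +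
          (QuadraticMap.polarBilin q₁).flip (coeffVec e Y s) = 0 :=
        e.ext fun i => by
          have := h' i (s + 1)
          rw [coeff_X_mul, hc] at this
          simpa [QuadraticMap.polarBilin_apply_apply] using this
      exact LinearMap.congr_fun this x
  · rintro ⟨h0, h1⟩ i
    ext s
    rw [sum_pencilMatrix_mul, one_mul, coeff_add, hc, coeff_zero]
    cases s with
    | zero => simp [h0]
    | succ s => rw [coeff_X_mul, hc, h1]

/-- The radical map in the affine chart `t₀ = 1`. -/
def affineRadical (j : Fin (2 * m + 1)) : k[X] :=
  MvPolynomial.aeval ![1, X] (radicalMap e q₀ q₁ j)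

/-- The vector coefficients of the radical map, indexed by natural numbers. -/
def radVec (i : ℕ) : E := coeffVec e (affineRadical e q₀ q₁) i

theorem affineRadical_eq (j : Fin (2 * m + 1)) : affineRadical e q₀ q₁ j =
    ∑ i ∈ Finset.range (m + 1), C (MvPolynomial.coeff
      (Finsupp.single 0 (m - i) + Finsupp.single 1 i) (radicalMap e q₀ q₁ j)) * X ^ i := by
  rw [affineRadical, aeval_binary_form (isHomogeneous_radicalMap e q₀ q₁ j)]
  simp [algebraMap_eq]

theorem coeff_affineRadical (j : Fin (2 * m + 1)) (i : ℕ) : (affineRadical e q₀ q₁ j).coeff i =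
    if i ≤ m then MvPolynomial.coeff
      (Finsupp.single 0 (m - i) + Finsupp.single 1 i) (radicalMap e q₀ q₁ j) else 0 := by
  rw [affineRadical_eq, finsetSum_coeff]
  simp only [coeff_C_mul, coeff_X_pow, mul_ite, mul_one, mul_zero]
  rw [Finset.sum_ite_eq]
  simp

theorem radicalVector_eq (i : Fin (m + 1)) : radicalVector e q₀ q₁ i = radVec e q₀ q₁ i := by
  rw [radicalVector, radVec, coeffVec]
  refine Finset.sum_congr rfl fun j _ => ?_
  rw [coeff_affineRadical, if_pos (Nat.lt_succ_iff.1 i.2)]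

theorem radVec_eq_zero {i : ℕ} (hi : m < i) : radVec e q₀ q₁ i = 0 := by
  rw [radVec, coeffVec]
  refine Finset.sum_eq_zero fun j _ => ?_
  rw [coeff_affineRadical, if_neg (by omega), zero_smul]

theorem aeval_zero_one_radicalMap (j : Fin (2 * m + 1)) :
    MvPolynomial.aeval ![(0 : k), 1] (radicalMap e q₀ q₁ j) = e.repr (radVec e q₀ q₁ m) j := by
  rw [aeval_binary_form (isHomogeneous_radicalMap e q₀ q₁ j), Finset.sum_eq_single m, radVec,
    repr_coeffVec, coeff_affineRadical, if_pos le_rfl]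
  · simp
  · intro i hi him
    rw [zero_pow, zero_mul, mul_zero]
    have := Finset.mem_range.1 hi
    omega
  · simp

section CharTwo

variable [CharP k 2]

theorem sum_pencilMatrix_mul_affineRadical (i : Fin (2 * m + 1)) :
    ∑ j, pencilMatrix e q₀ q₁ 1 X i j * affineRadical e q₀ q₁ j = 0 := by
  simp only [affineRadical, aeval_radicalMap]
  exact sum_mul_haf_erase _ (pencilMatrix_comm e q₀ q₁ _ _) (pencilMatrix_self e q₀ q₁ _ _)
    (Finset.mem_univ i)

theorem polar_radVec_zero (x : E) : QuadraticMap.polar q₀ x (radVec e q₀ q₁ 0) = 0 :=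
  ((sum_pencilMatrix_mul_eq_zero_iff e q₀ q₁ _).1
    (sum_pencilMatrix_mul_affineRadical e q₀ q₁)).1 x

theorem polar_radVec_succ (s : ℕ) (x : E) : QuadraticMap.polar q₀ x (radVec e q₀ q₁ (s + 1)) =
    QuadraticMap.polar q₁ x (radVec e q₀ q₁ s) := by
  have := ((sum_pencilMatrix_mul_eq_zero_iff e q₀ q₁ _).1
    (sum_pencilMatrix_mul_affineRadical e q₀ q₁)).2 s x
  rw [← CharTwo.sub_eq_add, sub_eq_zero] at this
  exact this

theorem polar_radVec_last (x : E) : QuadraticMap.polar q₁ x (radVec e q₀ q₁ m) = 0 := by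
  rw [← polar_radVec_succ, radVec_eq_zero e q₀ q₁ (Nat.lt_succ_self m), QuadraticMap.polar_zero_right]

/-- The relation `b₀(·,w_{s+1}) = b₁(·,w_s)` together with symmetry moves indices from one argument
to the other, until `w₀` appears, which lies in the radical of `b₀`. -/
theorem polar_one_radVec_radVec (i j : ℕ) :
    QuadraticMap.polar q₁ (radVec e q₀ q₁ i) (radVec e q₀ q₁ j) = 0 := by
  induction j generalizing i with
  | zero => rw [QuadraticMap.polar_comm, ← polar_radVec_succ, QuadraticMap.polar_comm,
      polar_radVec_zero]
  | succ j ih => rw [QuadraticMap.polar_comm, ← polar_radVec_succ, QuadraticMap.polar_comm,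
      polar_radVec_succ, ih]

theorem polar_zero_radVec_radVec (i j : ℕ) :
    QuadraticMap.polar q₀ (radVec e q₀ q₁ i) (radVec e q₀ q₁ j) = 0 := by
  cases j with
  | zero => rw [polar_radVec_zero]
  | succ j => rw [polar_radVec_succ, polar_one_radVec_radVec]

omit [CharP k 2] in
theorem affineRadical_eq_sum : affineRadical e q₀ q₁ = ∑ s ∈ Finset.range (m + 1),
    (X ^ s : k[X]) • fun j => algebraMap k k[X] (e.repr (radVec e q₀ q₁ s) j) := by
  funext j
  rw [affineRadical_eq, Finset.sum_apply]
  refine Finset.sum_congr rfl fun s hs => ?_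
  rw [radVec, Pi.smul_apply, repr_coeffVec, coeff_affineRadical,
    if_pos (Nat.lt_succ_iff.1 (Finset.mem_range.1 hs)), algebraMap_eq, smul_eq_mul, mul_comm]

omit [CharP k 2] in
theorem aeval_affineRadical (q : QuadraticForm k E)
    (hq : ∀ i j, QuadraticMap.polar q (radVec e q₀ q₁ i) (radVec e q₀ q₁ j) = 0) :
    MvPolynomial.aeval (affineRadical e q₀ q₁) (formPoly e q) =
      ∑ s ∈ Finset.range (m + 1), C (q (radVec e q₀ q₁ s)) * X ^ (2 * s) := by
  rw [affineRadical_eq_sum]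
  induction (m + 1) with
  | zero =>
    have := aeval_formPoly_smul e q (0 : k[X]) 0
    simpa using this
  | succ N ih =>
    rw [Finset.sum_range_succ, aeval_formPoly_add, ih, aeval_formPoly_smul, aeval_formPoly_repr,
      Finset.sum_range_succ, polarExt_smul_right]
    have h0 : polarExt e q (∑ s ∈ Finset.range N,
        (X ^ s : k[X]) • fun j => algebraMap k k[X] (e.repr (radVec e q₀ q₁ s) j))
        (fun j => algebraMap k k[X] (e.repr (radVec e q₀ q₁ N) j)) = 0 := by
      have hcomm : ∀ x y : Fin (2 * m + 1) → k[X], polarExt e q x y = polarExt e q y x := by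
        intro x y
        rw [polarExt, polarExt, Finset.sum_comm]
        refine Finset.sum_congr rfl fun i _ => Finset.sum_congr rfl fun j _ => ?_
        rw [QuadraticMap.polar_comm]; ring
      rw [hcomm, polarExt_sum_right]
      refine Finset.sum_eq_zero fun s _ => ?_
      rw [polarExt_smul_right, polarExt_repr, hq, map_zero, mul_zero]
    rw [h0, mul_zero, add_zero, algebraMap_eq]
    ring

/-- Mutual orthogonality of the `w_s` removes all cross terms, so only even powers come from `q₀`
and only odd powers from `q₁`. This identifies each `a_i` with a value of `q₀` or `q₁` on some
`w_s`. -/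
theorem dehomHalfDisc_eq : dehomHalfDisc e q₀ q₁ = ∑ s ∈ Finset.range (m + 1),
    (C (q₀ (radVec e q₀ q₁ s)) * X ^ (2 * s) + C (q₁ (radVec e q₀ q₁ s)) * X ^ (2 * s + 1)) := by
  have h : ∀ q, MvPolynomial.aeval ![(1 : k[X]), X] (MvPolynomial.aeval (radicalMap e q₀ q₁)
      (formPoly e q)) = MvPolynomial.aeval (affineRadical e q₀ q₁) (formPoly e q) := fun q =>
    MvPolynomial.comp_aeval_apply _ _ _
  rw [dehomHalfDisc, halfDisc, map_add, map_mul, map_mul, h, h,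
    aeval_affineRadical e q₀ q₁ q₀ (polar_zero_radVec_radVec e q₀ q₁),
    aeval_affineRadical e q₀ q₁ q₁ (polar_one_radVec_radVec e q₀ q₁), Finset.sum_add_distrib,
    Finset.mul_sum, Finset.mul_sum]
  simp only [MvPolynomial.aeval_X, Matrix.cons_val_zero, Matrix.cons_val_one, one_mul]
  congr 1
  exact Finset.sum_congr rfl fun s _ => by ring

theorem coeff_dehomHalfDisc_even (i : ℕ) :
    (dehomHalfDisc e q₀ q₁).coeff (2 * i) = q₀ (radVec e q₀ q₁ i) := by
  rw [dehomHalfDisc_eq, finsetSum_coeff]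
  simp only [coeff_add, coeff_C_mul, coeff_X_pow]
  rw [Finset.sum_congr rfl (g := fun s => if i = s then q₀ (radVec e q₀ q₁ s) else 0),
    Finset.sum_ite_eq]
  · split_ifs with h
    · rfl
    · rw [radVec_eq_zero e q₀ q₁ (by simpa using h), QuadraticMap.map_zero]
  · intro s _
    have : 2 * i ≠ 2 * s + 1 := by omega
    by_cases h : i = s <;> simp [h, this]

theorem coeff_dehomHalfDisc_odd (i : ℕ) :
    (dehomHalfDisc e q₀ q₁).coeff (2 * i + 1) = q₁ (radVec e q₀ q₁ i) := by
  rw [dehomHalfDisc_eq, finsetSum_coeff]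
  simp only [coeff_add, coeff_C_mul, coeff_X_pow]
  rw [Finset.sum_congr rfl (g := fun s => if i = s then q₁ (radVec e q₀ q₁ s) else 0),
    Finset.sum_ite_eq]
  · split_ifs with h
    · rfl
    · rw [radVec_eq_zero e q₀ q₁ (by simpa using h), QuadraticMap.map_zero]
  · intro s _
    have : 2 * i + 1 ≠ 2 * s := by omega
    by_cases h : i = s <;> simp [h, this]

theorem natDegree_dehomHalfDisc_le : (dehomHalfDisc e q₀ q₁).natDegree ≤ 2 * m + 1 := by
  rw [natDegree_le_iff_coeff_eq_zero]
  intro N hN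
  obtain ⟨i, rfl | rfl⟩ := N.even_or_odd'
  · rw [coeff_dehomHalfDisc_even, radVec_eq_zero e q₀ q₁ (by omega), QuadraticMap.map_zero]
  · rw [coeff_dehomHalfDisc_odd, radVec_eq_zero e q₀ q₁ (by omega), QuadraticMap.map_zero]

end CharTwo

end QuadPencil

end

/-! ### Uniqueness of the radical map and independence of its coefficients -/

noncomputable section

namespace QuadPencil

variable {k : Type*} [Field k] [CharP k 2] {E : Type*} [AddCommGroup E] [Module k E] {m : ℕ}
  (e : Module.Basis (Fin (2 * m + 1)) k E) (q₀ q₁ : QuadraticForm k E)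

/-- For a regular pair, the coordinates of the radical map have no common factor. -/
theorem span_affineRadical_eq_top (hreg : IsRegularPair e q₀ q₁) :
    Ideal.span (Set.range (affineRadical e q₀ q₁)) = ⊤ := by
  obtain ⟨g, hg⟩ := (IsPrincipalIdealRing.principal
    (Ideal.span (Set.range (affineRadical e q₀ q₁)))).principal
  by_cases hdeg : g.degree = 0
  · rw [hg]
    exact Ideal.span_singleton_eq_top.2 (isUnit_iff_degree_eq_zero.2 hdeg)
  exfalso
  -- A generator `g` of degree different from zero, possibly `g = 0`, has a geometric root, at which
  -- all coordinates of `Ω` would vanish.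
  obtain ⟨τ, hτ⟩ := IsAlgClosed.exists_aeval_eq_zero (AlgebraicClosure k) g hdeg
  obtain ⟨j, hj⟩ := exists_aeval_radicalMap_ne_zero e q₀ q₁ hreg τ
  apply hj
  have h1 : affineRadical e q₀ q₁ j ∈ Ideal.span (Set.range (affineRadical e q₀ q₁)) :=
    Ideal.subset_span ⟨j, rfl⟩
  rw [hg] at h1
  obtain ⟨d, hd⟩ := Ideal.mem_span_singleton'.1 h1
  have h2 : aeval τ (affineRadical e q₀ q₁ j) = 0 := by rw [← hd, map_mul, hτ, mul_zero]
  rw [← h2, affineRadical, MvPolynomial.comp_aeval_apply]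
  congr 2
  funext i
  fin_cases i <;> simp

/-- Proportionality to `Ω` comes from Cramer's rule, and a Bézout relation `∑ c_i Ω_i = 1` turns it
into divisibility with quotient `∑ c_i Y_i`. -/
theorem affineRadical_dvd (hreg : IsRegularPair e q₀ q₁) (Y : Fin (2 * m + 1) → k[X])
    (hY : ∀ i, ∑ j, pencilMatrix e q₀ q₁ 1 X i j * Y j = 0) (j : Fin (2 * m + 1)) :
    (∀ i, affineRadical e q₀ q₁ j * Y i = affineRadical e q₀ q₁ i * Y j) ∧
      affineRadical e q₀ q₁ j ∣ Y j := by
  have h1 : ∀ i, affineRadical e q₀ q₁ j * Y i = affineRadical e q₀ q₁ i * Y j := by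
    intro i
    simp only [affineRadical, aeval_radicalMap]
    exact haf_erase_mul_eq _ (pencilMatrix_comm e q₀ q₁ _ _) (pencilMatrix_self e q₀ q₁ _ _) Y
      (fun i _ => hY i) (Finset.mem_univ i) (Finset.mem_univ j)
  refine ⟨h1, ?_⟩
  have h2 : (1 : k[X]) ∈ Ideal.span (Set.range (affineRadical e q₀ q₁)) := by
    rw [span_affineRadical_eq_top e q₀ q₁ hreg]; trivial
  obtain ⟨c, hc⟩ := (Ideal.mem_span_range_iff_exists_fun).1 h2
  refine ⟨∑ i, c i * Y i, ?_⟩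
  calc Y j = (∑ i, c i * affineRadical e q₀ q₁ i) * Y j := by rw [hc, one_mul]
    _ = affineRadical e q₀ q₁ j * ∑ i, c i * Y i := by
      rw [Finset.sum_mul, Finset.mul_sum]
      exact Finset.sum_congr rfl fun i _ => by linear_combination - c i * h1 i

/-- The radical map spans the space of its analogues of the same degree. -/
theorem exists_eq_smul_radVec (hreg : IsRegularPair e q₀ q₁) (hm : radVec e q₀ q₁ m ≠ 0)
    (y : ℕ → E) (hy : ∀ s, m < s → y s = 0) (h0 : ∀ x, QuadraticMap.polar q₀ x (y 0) = 0)
    (hs : ∀ s x, QuadraticMap.polar q₀ x (y (s + 1)) = QuadraticMap.polar q₁ x (y s)) :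
    ∃ c : k, ∀ s, y s = c • radVec e q₀ q₁ s := by
  let Y : Fin (2 * m + 1) → k[X] := fun j => ∑ s ∈ Finset.range (m + 1), C (e.repr (y s) j) * X ^ s
  have hYc : ∀ j s, (Y j).coeff s = e.repr (y s) j := by
    intro j s
    simp only [Y, finsetSum_coeff, coeff_C_mul, coeff_X_pow, mul_ite, mul_one, mul_zero]
    rw [Finset.sum_ite_eq]
    split_ifs with h
    · rfl
    · rw [hy s (by simpa using h)]; simp
  have hYv : ∀ s, coeffVec e Y s = y s := by
    intro s
    simp only [coeffVec, hYc, e.sum_repr]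
  have hker : ∀ i, ∑ j, pencilMatrix e q₀ q₁ 1 X i j * Y j = 0 := by
    rw [sum_pencilMatrix_mul_eq_zero_iff]
    simp only [hYv]
    exact ⟨h0, fun s x => by rw [hs, CharTwo.add_self_eq_zero]⟩
  obtain ⟨j, hj⟩ : ∃ j, e.repr (radVec e q₀ q₁ m) j ≠ 0 := by
    by_contra! h
    exact hm (e.repr.map_eq_zero_iff.1 (Finsupp.ext h))
  obtain ⟨h1, D, hD⟩ := affineRadical_dvd e q₀ q₁ hreg Y hker j
  have hcj : (affineRadical e q₀ q₁ j).coeff m ≠ 0 := by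
    rwa [radVec, repr_coeffVec] at hj
  have hne : affineRadical e q₀ q₁ j ≠ 0 := by
    intro h; rw [h] at hcj; exact hcj rfl
  -- The index `j` was chosen so that `Ω_j` has degree `m`, the largest degree allowed for `Y j`.
  have hDdeg : D.natDegree = 0 := by
    by_cases hD0 : D = 0
    · rw [hD0, natDegree_zero]
    have h2 : (Y j).natDegree ≤ m := by
      rw [natDegree_le_iff_coeff_eq_zero]
      intro N hN
      rw [hYc, hy N hN]; simp
    have h3 := le_natDegree_of_ne_zero hcj
    rw [hD, natDegree_mul hne hD0] at h2
    omega
  obtain ⟨c, rfl⟩ := natDegree_eq_zero.1 hDdeg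
  refine ⟨c, fun s => e.repr.injective (Finsupp.ext fun i => ?_)⟩
  have h4 : Y i = C c * affineRadical e q₀ q₁ i := by
    apply mul_left_cancel₀ hne
    rw [h1, hD]; ring
  rw [← hYc, h4, coeff_C_mul, map_smul, Finsupp.smul_apply, radVec, repr_coeffVec, smul_eq_mul]

/-- The value of `Ω` at `(0, 1)` is `w_m`, so its coordinates are the sub-Pfaffians of `b₁`; when
they are not all zero, they span the radical of `b₁`. -/
theorem exists_eq_smul_radVec_of_polar_eq_zero (hm : radVec e q₀ q₁ m ≠ 0) (x : E)
    (hx : ∀ z, QuadraticMap.polar q₁ z x = 0) : ∃ c : k, x = c • radVec e q₀ q₁ m := by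
  obtain ⟨j, hj⟩ : ∃ j, e.repr (radVec e q₀ q₁ m) j ≠ 0 := by
    by_contra! h
    exact hm (e.repr.map_eq_zero_iff.1 (Finsupp.ext h))
  refine ⟨(e.repr (radVec e q₀ q₁ m) j)⁻¹ * e.repr x j,
    e.repr.injective (Finsupp.ext fun i => ?_)⟩
  have h1 : e.repr (radVec e q₀ q₁ m) j * e.repr x i =
      e.repr (radVec e q₀ q₁ m) i * e.repr x j := by
    rw [← aeval_zero_one_radicalMap, ← aeval_zero_one_radicalMap, aeval_radicalMap,
      aeval_radicalMap]
    refine haf_erase_mul_eq _ (pencilMatrix_comm e q₀ q₁ _ _) (pencilMatrix_self e q₀ q₁ _ _)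
      (fun i => e.repr x i) (fun i _ => ?_) (Finset.mem_univ i) (Finset.mem_univ j)
    rw [sum_pencilMatrix_mul, zero_mul, zero_add, one_mul, ← hx (e i)]
    rw [← QuadraticMap.polarBilin_apply_apply]
    conv_rhs => rw [← e.sum_repr x]
    rw [map_sum]
    exact Finset.sum_congr rfl fun l _ => by
      rw [map_smul, smul_eq_mul, mul_comm]
      rfl
  rw [map_smul, Finsupp.smul_apply, smul_eq_mul]
  field_simp
  linear_combination h1

omit [CharP k 2] in
/-- A pencil of linear maps into a space of smaller dimension has a kernel vector of small
degree. -/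
theorem exists_kernel_sequence {W U : Type*} [AddCommGroup W] [Module k W] [AddCommGroup U]
    [Module k U] [FiniteDimensional k W] [FiniteDimensional k U] (β₀ β₁ : W →ₗ[k] U) (m : ℕ)
    (hU : Module.finrank k U < Module.finrank k W) (hW : Module.finrank k W ≤ m) :
    ∃ y : ℕ → W, (∃ s, y s ≠ 0) ∧ (∀ s, m ≤ s → y s = 0) ∧ β₀ (y 0) = 0 ∧
      ∀ s, β₀ (y (s + 1)) + β₁ (y s) = 0 := by
  let P : ℕ → (Fin m → W) →ₗ[k] W := fun s => if h : s < m then LinearMap.proj ⟨s, h⟩ else 0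
  have hP : ∀ s, m ≤ s → P s = 0 := fun s h => dif_neg (not_lt.2 h)
  let Θ : (Fin m → W) →ₗ[k] (Fin (m + 1) → U) := LinearMap.pi fun s =>
    β₀ ∘ₗ P s + β₁ ∘ₗ (if (s : ℕ) = 0 then 0 else P ((s : ℕ) - 1))
  have hΘ : LinearMap.ker Θ ≠ ⊥ := by
    intro hker
    have h1 := LinearMap.finrank_le_finrank_of_injective (LinearMap.ker_eq_bot.1 hker)
    rw [Module.finrank_pi_fintype, Module.finrank_pi_fintype] at h1
    simp only [Finset.sum_const, Finset.card_univ, Fintype.card_fin, smul_eq_mul] at h1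
    obtain ⟨d, hd⟩ := Nat.exists_eq_add_of_lt hU
    rw [hd] at h1 hW
    -- With `r = dim W ≤ m` and `dim U ≤ r - 1`, there are `m r` unknowns and at most `(m + 1)(r -
    -- 1) = m r - (m + 1 - r)` equations.
    nlinarith
  obtain ⟨u, hu, hu0⟩ := Submodule.exists_mem_ne_zero_of_ne_bot hΘ
  have hu' : ∀ s (hs : s < m + 1), _ := fun s hs => congrFun (LinearMap.mem_ker.1 hu) ⟨s, hs⟩
  refine ⟨fun s => P s u, ?_, fun s hs => by simp [hP s hs], ?_, fun s => ?_⟩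
  · by_contra! h
    refine hu0 (funext fun i => ?_)
    simpa [P] using h i
  · simpa [Θ] using hu' 0 (Nat.succ_pos m)
  · by_cases hs : s < m
    · have h1 : β₀ (P (s + 1) u) + β₁ ((if s + 1 = 0 then 0 else P (s + 1 - 1)) u) = 0 :=
        hu' (s + 1) (by omega)
      rwa [if_neg (Nat.succ_ne_zero s), Nat.add_sub_cancel] at h1
    · simp [hP s (by omega), hP (s + 1) (by omega)]

/-- If the span `W` had dimension at most `m`, the pencil restricted to `W` would map into `b₁(W)`,
which is smaller than `W` because `w_m` is in the radical of `b₁`. That yields a nonzero kernel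
chain of degree below `m`, contradicting uniqueness of `Ω`. -/
theorem linearIndependent_radVec (hreg : IsRegularPair e q₀ q₁) (hm : radVec e q₀ q₁ m ≠ 0) :
    LinearIndependent k (fun i : Fin (m + 1) => radVec e q₀ q₁ i) := by
  have : FiniteDimensional k E := e.finiteDimensional_of_finite
  by_contra hli
  rw [linearIndependent_iff_card_eq_finrank_span] at hli
  set W := Submodule.span k (Set.range fun i : Fin (m + 1) => radVec e q₀ q₁ i)
  have hmem : ∀ s, radVec e q₀ q₁ s ∈ W := by
    intro s
    by_cases h : s ≤ m
    · exact Submodule.subset_span ⟨⟨s, Nat.lt_succ_of_le h⟩, rfl⟩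
    · rw [radVec_eq_zero e q₀ q₁ (by omega)]; exact W.zero_mem
  have hr : Module.finrank k W ≤ m := by
    have h1 : Module.finrank k W ≤ Fintype.card (Fin (m + 1)) := finrank_range_le_card _
    have h2 : Fintype.card (Fin (m + 1)) ≠ Module.finrank k W := hli
    rw [Fintype.card_fin] at h1 h2
    omega
  let b₀ : W →ₗ[k] (E →ₗ[k] k) := (QuadraticMap.polarBilin q₀).comp W.subtype
  let b₁ : W →ₗ[k] (E →ₗ[k] k) := (QuadraticMap.polarBilin q₁).comp W.subtype
  have hU : Module.finrank k (LinearMap.range b₁) < Module.finrank k W := by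
    rw [← LinearMap.finrank_range_add_finrank_ker b₁]
    have : 0 < Module.finrank k (LinearMap.ker b₁) := by
      rw [Module.finrank_pos_iff_exists_ne_zero]
      refine ⟨⟨⟨radVec e q₀ q₁ m, hmem m⟩, ?_⟩, ?_⟩
      · rw [LinearMap.mem_ker]
        ext x
        exact (QuadraticMap.polar_comm _ _ _).trans (polar_radVec_last e q₀ q₁ x)
      · intro h
        exact hm (congrArg (fun z : LinearMap.ker b₁ => ((z : W) : E)) h)
    omega
  have hb₀ : ∀ w : W, b₀ w ∈ LinearMap.range b₁ := by
    rintro ⟨w, hw⟩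
    have hle : W ≤ ((LinearMap.range b₁).comap (QuadraticMap.polarBilin q₀)) := by
      refine Submodule.span_le.2 ?_
      rintro _ ⟨⟨s, hs⟩, rfl⟩
      rw [SetLike.mem_coe, Submodule.mem_comap]
      cases s with
      | zero =>
        convert Submodule.zero_mem _
        ext x
        exact (QuadraticMap.polar_comm _ _ _).trans (polar_radVec_zero e q₀ q₁ x)
      | succ s =>
        refine ⟨⟨radVec e q₀ q₁ s, hmem s⟩, ?_⟩
        ext x
        exact (QuadraticMap.polar_comm _ _ _).trans ((polar_radVec_succ e q₀ q₁ s x).symm.trans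
          (QuadraticMap.polar_comm _ _ _))
    exact hle hw
  let β₀ : W →ₗ[k] LinearMap.range b₁ := b₀.codRestrict _ hb₀
  let β₁ : W →ₗ[k] LinearMap.range b₁ := b₁.rangeRestrict
  obtain ⟨y, ⟨s, hs⟩, hy, hy0, hys⟩ := exists_kernel_sequence (U := LinearMap.range b₁) β₀ β₁ m hU hr
  obtain ⟨c, hc⟩ := exists_eq_smul_radVec e q₀ q₁ hreg hm (fun s => (y s : E))
    (fun s hs => by rw [hy s hs.le]; rfl)
    (fun x => by
      rw [QuadraticMap.polar_comm]
      exact LinearMap.congr_fun (congrArg Subtype.val hy0) x)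
    (fun s x => by
      rw [QuadraticMap.polar_comm, QuadraticMap.polar_comm q₁, ← sub_eq_zero, CharTwo.sub_eq_add]
      exact LinearMap.congr_fun (congrArg Subtype.val (hys s)) x)
  -- The chain stops before degree `m`, where `Ω` has the nonzero coefficient `w_m`.
  have hc0 : c = 0 := by
    have := hc m
    rw [hy m le_rfl] at this
    simpa [hm] using this.symm
  refine hs (Subtype.ext ?_)
  rw [hc s, hc0, zero_smul]
  rfl

end QuadPencil

end

/-! ### Existence of Kronecker bases -/

noncomputable section

namespace QuadPencil

/-- A solution of the linear system that makes a dual frame isotropic for two alternating forms. -/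
def isotropyCorrection {R : Type*} [AddCommGroup R] (α β : ℕ → ℕ → R) : ℕ → ℕ → R
  | 0, _ => 0
  | i + 1, j => isotropyCorrection α β i (j + 1) + α (i + 1) j + β i j

/-- Eliminating `h(j,i+1)` between the first equation at `(i+1,j)` and the second at `(i,j)` gives
the recursion that defines the correction `h`; the values `h(0,·)` are free and set to zero.
Conversely the recursion gives both equations by induction on the distance of the indices, starting
from the fact that `α` and `β` are alternating. -/
theorem isotropyCorrection_spec {R : Type*} [CommRing R] [CharP R 2] (α β : ℕ → ℕ → R)
    (hα : ∀ i j, α i j = α j i) (hα0 : ∀ i, α i i = 0) (hβ : ∀ i j, β i j = β j i)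
    (hβ0 : ∀ i, β i i = 0) (i l : ℕ) :
    isotropyCorrection α β i l + isotropyCorrection α β l i = α i l ∧
    isotropyCorrection α β i (l + 1) + isotropyCorrection α β l (i + 1) = β i l := by
  have h2 : ∀ x : R, x + x = 0 := CharTwo.add_self_eq_zero
  have key : ∀ d i,
      (isotropyCorrection α β i (i + d) + isotropyCorrection α β (i + d) i = α i (i + d) ∧
      isotropyCorrection α β i (i + d + 1) + isotropyCorrection α β (i + d) (i + 1) =
        β i (i + d)) := by
    intro d
    induction d using Nat.strong_induction_on with
    | _ d ih =>
      intro i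
      rcases d with _ | _ | d
      · simp only [add_zero, h2, hα0, hβ0, and_self]
      · have h1 : isotropyCorrection α β (i + 1) i =
            isotropyCorrection α β i (i + 1) + α (i + 1) i + β i i := rfl
        have h3 : isotropyCorrection α β (i + 1) (i + 1) =
            isotropyCorrection α β i (i + 1 + 1) + α (i + 1) (i + 1) + β i (i + 1) := rfl
        simp only [zero_add]
        rw [h1, h3, hα0, hβ0, hα (i + 1) i]
        exact ⟨by linear_combination h2 (isotropyCorrection α β i (i + 1)),
          by linear_combination h2 (isotropyCorrection α β i (i + 1 + 1))⟩
      -- At distance `d + 2`, the first equation reduces to the second at distance `d + 1`, and the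
      -- second reduces to itself at distance `d` with `i` shifted by one.
      · have hQ := (ih (d + 1) (by omega) i).2
        have hQ' := (ih d (by omega) (i + 1)).2
        have h1 : isotropyCorrection α β (i + d + 1 + 1) i =
          isotropyCorrection α β (i + d + 1) (i + 1) + α (i + d + 1 + 1) i + β (i + d + 1) i := rfl
        have h3 : isotropyCorrection α β (i + d + 1 + 1) (i + 1) =
          isotropyCorrection α β (i + d + 1) (i + 2) + α (i + d + 1 + 1) (i + 1)
            + β (i + d + 1) (i + 1) := rfl
        have h4 : isotropyCorrection α β (i + 1) (i + d + 1 + 1) =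
          isotropyCorrection α β i (i + d + 1 + 1 + 1) + α (i + 1) (i + d + 1 + 1)
            + β i (i + d + 1 + 1) := rfl
        have e1 : i + (d + 1 + 1) = i + d + 1 + 1 := rfl
        have e2 : i + (d + 1) = i + d + 1 := rfl
        have e3 : i + 1 + d = i + d + 1 := by omega
        rw [e2] at hQ
        rw [e3] at hQ'
        rw [e1, h1, h3]
        rw [h4, show i + 1 + 1 = i + 2 from rfl] at hQ'
        rw [hα (i + d + 1 + 1) i, hα (i + d + 1 + 1) (i + 1), hβ (i + d + 1) i,
          hβ (i + d + 1) (i + 1)]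
        constructor
        · linear_combination hQ + h2 (β i (i + d + 1))
        · linear_combination hQ' + h2 (β (i + 1) (i + d + 1))
            - h2 (β i (i + d + 1 + 1))
  rcases le_total i l with h | h
  · obtain ⟨d, rfl⟩ := Nat.exists_eq_add_of_le h
    exact key d i
  · obtain ⟨d, rfl⟩ := Nat.exists_eq_add_of_le h
    have := key d l
    rw [hα, hβ, add_comm, add_comm (isotropyCorrection α β (l + d) (l + 1))]
    exact this

/-- Linearly independent functionals take arbitrary values simultaneously. -/
theorem exists_dual_family {k E : Type*} [Field k] [AddCommGroup E] [Module k E] {m : ℕ}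
    (φ : Fin m → Module.Dual k E) (hφ : LinearIndependent k φ) :
    ∃ v : Fin m → E, ∀ i j, φ i (v j) = if i = j then 1 else 0 := by
  have hsurj : LinearMap.range (LinearMap.pi φ) = ⊤ := by
    by_contra hne
    obtain ⟨f, hf0, hf⟩ := Submodule.exists_le_ker_of_lt_top _ (lt_top_iff_ne_top.2 hne)
    apply hf0
    rw [Fintype.linearIndependent_iff] at hφ
    -- A functional vanishing on the range of the joint map is a linear relation among the `φ i`.
    have h1 := hφ (fun i => f (Pi.single i 1)) (by
      ext x
      have h2 : f (LinearMap.pi φ x) = 0 := hf ⟨x, rfl⟩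
      rw [LinearMap.pi_apply_eq_sum_univ f] at h2
      have h3 : ∀ i : Fin m, (Pi.single i 1 : Fin m → k) = fun j => if i = j then 1 else 0 :=
        fun i => funext fun j => by simp [Pi.single_apply, eq_comm]
      simpa [mul_comm, h3] using h2)
    ext i
    simpa using h1 i
  choose v hv using fun j => LinearMap.range_eq_top.1 hsurj (Pi.single j 1)
  refine ⟨v, fun i j => ?_⟩
  have := congrFun (hv j) i
  rwa [LinearMap.pi_apply, Pi.single_apply] at this

variable {k : Type*} [Field k] [CharP k 2] {E : Type*} [AddCommGroup E] [Module k E] {m : ℕ}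
  (e : Module.Basis (Fin (2 * m + 1)) k E) (q₀ q₁ : QuadraticForm k E)

omit [CharP k 2] in
theorem polar_sum_right {ι : Type*} (q : QuadraticForm k E) (x : E) (s : Finset ι) (y : ι → E) :
    QuadraticMap.polar q x (∑ i ∈ s, y i) = ∑ i ∈ s, QuadraticMap.polar q x (y i) := by
  simp only [← QuadraticMap.polarBilin_apply_apply, map_sum]

/-- The radical of `b₁` is spanned by `w_m`, so `w_0, …, w_{m-1}` define independent functionals
through `b₁` and have a dual family `v_l`. The shift relation yields the pairing with `b₀` for free.
Adding combinations of the `w_j` to the `v_l` does not change these pairings and can make the `v_l`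
isotropic for both forms. -/
theorem exists_isKroneckerBasis (hreg : IsRegularPair e q₀ q₁) (hm : radVec e q₀ q₁ m ≠ 0) :
    ∃ B, IsKroneckerBasis e q₀ q₁ B := by
  set w := radVec e q₀ q₁ with hw
  have hli := linearIndependent_radVec e q₀ q₁ hreg hm
  have hφ : LinearIndependent k (fun i : Fin m => QuadraticMap.polarBilin q₁ (w i)) := by
    rw [Fintype.linearIndependent_iff]
    intro g hg
    obtain ⟨c, hc⟩ := exists_eq_smul_radVec_of_polar_eq_zero e q₀ q₁ hm (∑ i : Fin m, g i • w i)
      (fun z => by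
        have := LinearMap.congr_fun hg z
        rw [QuadraticMap.polar_comm, ← QuadraticMap.polarBilin_apply_apply, map_sum]
        simpa using this)
    rw [Fintype.linearIndependent_iff] at hli
    -- A relation among the functionals puts `∑ g_i w_i` into the radical `k w_m` of `b₁`, which is
    -- a relation among all the `w_i`.
    have h1 := hli (Fin.snoc g (-c)) (by
      rw [Fin.sum_univ_castSucc]
      simp only [Fin.snoc_castSucc, Fin.snoc_last, Fin.val_castSucc, Fin.val_last]
      rw [← hw, hc, neg_smul, add_neg_cancel])
    intro i
    simpa using h1 i.castSucc
  obtain ⟨v₀, hv₀⟩ := exists_dual_family _ hφ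
  let v : ℕ → E := fun l => if h : l < m then v₀ ⟨l, h⟩ else 0
  have hwv₁ : ∀ j l, l < m → QuadraticMap.polar q₁ (w j) (v l) = if j = l then 1 else 0 := by
    intro j l hl
    by_cases hj : j < m
    · simp only [v, dif_pos hl]
      simpa using hv₀ ⟨j, hj⟩ ⟨l, hl⟩
    · rw [if_neg (by omega)]
      by_cases hjm : j = m
      · rw [hjm, QuadraticMap.polar_comm, polar_radVec_last]
      · rw [hw, radVec_eq_zero e q₀ q₁ (by omega), QuadraticMap.polar_zero_left]
  have hwv₀ : ∀ j l, l < m → QuadraticMap.polar q₀ (w j) (v l) = if j = l + 1 then 1 else 0 := by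
    intro j l hl
    rw [QuadraticMap.polar_comm]
    cases j with
    | zero => rw [hw, polar_radVec_zero, if_neg (by omega)]
    | succ j =>
      rw [hw, polar_radVec_succ, QuadraticMap.polar_comm, ← hw, hwv₁ j l hl]
      simp
  let α : ℕ → ℕ → k := fun i l => QuadraticMap.polar q₁ (v i) (v l)
  let β : ℕ → ℕ → k := fun i l => QuadraticMap.polar q₀ (v i) (v l)
  let h := isotropyCorrection α β
  have hspec := isotropyCorrection_spec α β (fun i j => QuadraticMap.polar_comm _ _ _)
    (fun i => polar_self_eq_zero _ _) (fun i j => QuadraticMap.polar_comm _ _ _)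
    (fun i => polar_self_eq_zero _ _)
  -- The corrected vectors are `v i + u i`. As `b₁(v_i, u_l) = h(l,i)` and `b₀(v_i, u_l) =
  -- h(l,i+1)`, their isotropy is exactly the system solved by `h`.
  let u : ℕ → E := fun i => ∑ j ∈ Finset.range (m + 1), h i j • w j
  have hwu : ∀ (q : QuadraticForm k E), (∀ i j, QuadraticMap.polar q (w i) (w j) = 0) →
      ∀ i j, QuadraticMap.polar q (w i) (u j) = 0 := by
    intro q hq i j
    rw [polar_sum_right]
    exact Finset.sum_eq_zero fun l _ => by rw [QuadraticMap.polar_smul_right, hq, smul_zero]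
  have huu : ∀ (q : QuadraticForm k E), (∀ i j, QuadraticMap.polar q (w i) (w j) = 0) →
      ∀ i j, QuadraticMap.polar q (u i) (u j) = 0 := by
    intro q hq i j
    rw [polar_sum_right]
    exact Finset.sum_eq_zero fun l _ => by
      rw [QuadraticMap.polar_smul_right, QuadraticMap.polar_comm, hwu q hq, smul_zero]
  have hvu : ∀ (q : QuadraticForm k E) (d : ℕ), d ≤ 1 →
      (∀ j l, l < m → QuadraticMap.polar q (w j) (v l) = if j = l + d then 1 else 0) →
      ∀ i l, i < m → QuadraticMap.polar q (v i) (u l) = h l (i + d) := by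
    intro q d hd hq i l hi
    rw [polar_sum_right, Finset.sum_eq_single (i + d)]
    · rw [QuadraticMap.polar_smul_right, QuadraticMap.polar_comm, hq _ _ hi, if_pos rfl,
        smul_eq_mul, mul_one]
    · intro j _ hj
      rw [QuadraticMap.polar_smul_right, QuadraticMap.polar_comm, hq _ _ hi, if_neg hj, smul_zero]
    · intro hn
      simp only [Finset.mem_range] at hn
      omega
  have hww₁ : ∀ i j, QuadraticMap.polar q₁ (w i) (w j) = 0 := polar_one_radVec_radVec e q₀ q₁
  have hww₀ : ∀ i j, QuadraticMap.polar q₀ (w i) (w j) = 0 := polar_zero_radVec_radVec e q₀ q₁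
  have hvv₁ : ∀ i l, i < m → l < m → QuadraticMap.polar q₁ (v i + u i) (v l + u l) = 0 := by
    intro i l hi hl
    have h1 := hvu q₁ 0 zero_le_one hwv₁
    rw [QuadraticMap.polar_add_left, QuadraticMap.polar_add_right, QuadraticMap.polar_add_right,
      huu q₁ hww₁, h1 i l hi, QuadraticMap.polar_comm _ (u i), h1 l i hl, add_zero, add_zero,
      add_zero, add_assoc, add_comm (h l i), (hspec i l).1]
    exact CharTwo.add_self_eq_zero _
  have hvv₀ : ∀ i l, i < m → l < m → QuadraticMap.polar q₀ (v i + u i) (v l + u l) = 0 := by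
    intro i l hi hl
    have h1 := hvu q₀ 1 le_rfl hwv₀
    rw [QuadraticMap.polar_add_left, QuadraticMap.polar_add_right, QuadraticMap.polar_add_right,
      huu q₀ hww₀, h1 i l hi, QuadraticMap.polar_comm _ (u i), h1 l i hl, add_zero, add_assoc,
      add_comm (h l (i + 1)), (hspec i l).2]
    exact CharTwo.add_self_eq_zero _
  let b : Fin (m + 1) ⊕ Fin m → E := Sum.elim (fun i => w i) (fun i => v i + u i)
  have hb : LinearIndependent k b := by
    rw [Fintype.linearIndependent_iff]
    intro g hg
    rw [Fintype.sum_sum_type] at hg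
    simp only [b, Sum.elim_inl, Sum.elim_inr] at hg
    have hr : ∀ i, g (.inr i) = 0 := by
      intro i
      have h1 := congrArg (QuadraticMap.polar q₁ (w i)) hg
      rw [QuadraticMap.polar_add_right, polar_sum_right, polar_sum_right,
        QuadraticMap.polar_zero_right] at h1
      simp only [QuadraticMap.polar_smul_right, hww₁, QuadraticMap.polar_add_right,
        hwu q₁ hww₁, hwv₁ _ _ (Fin.is_lt _), Finset.sum_const_zero, add_zero, zero_add,
        smul_eq_mul, mul_ite, mul_one, mul_zero, Fin.val_inj, Finset.sum_ite_eq,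
        Finset.mem_univ, if_true] at h1
      exact h1
    simp only [hr, zero_smul, Finset.sum_const_zero, add_zero] at hg
    have hl := Fintype.linearIndependent_iff.1 hli _ hg
    rintro (i | i)
    · exact hl i
    · exact hr i
  have hcard : Fintype.card (Fin (m + 1) ⊕ Fin m) = Module.finrank k E := by
    rw [Module.finrank_eq_card_basis e, Fintype.card_sum, Fintype.card_fin, Fintype.card_fin,
      Fintype.card_fin]
    omega
  let B := basisOfLinearIndependentOfCardEqFinrank hb hcard
  have hBl : ∀ i : Fin (m + 1), B (.inl i) = w i := fun i => by
    rw [coe_basisOfLinearIndependentOfCardEqFinrank]; rfl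
  have hBr : ∀ i : Fin m, B (.inr i) = v i + u i := fun i => by
    rw [coe_basisOfLinearIndependentOfCardEqFinrank]; rfl
  refine ⟨B, ⟨fun i j => ?_, fun i j => ?_, fun i j => ?_, fun i j => ?_, fun i j => ?_,
    fun i j => ?_, fun i => ?_⟩⟩
  · rw [hBl, hBl, hww₀]
  · rw [hBl, hBl, hww₁]
  · rw [hBr, hBr, hvv₀ _ _ i.2 j.2]
  · rw [hBr, hBr, hvv₁ _ _ i.2 j.2]
  · rw [hBl, hBr, QuadraticMap.polar_add_right, hwu q₀ hww₀, hwv₀ _ _ j.2, add_zero]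
    simp [Fin.ext_iff]
  · rw [hBl, hBr, QuadraticMap.polar_add_right, hwu q₁ hww₁, hwv₁ _ _ j.2, add_zero]
    simp [Fin.ext_iff]
  · rw [hBl, radicalVector_eq]

end QuadPencil

end

/-! ### Squares and idempotents in `k[T]/(f)` -/

noncomputable section

namespace QuadPencil

theorem sum_antidiagonal_odd {R : Type*} [CommRing R] [CharP R 2] (a : ℕ → R) (i : ℕ) :
    ∑ p ∈ Finset.HasAntidiagonal.antidiagonal (2 * i + 1), a p.1 * a p.2 = 0 := by
  refine Finset.sum_involution (fun p _ => p.swap) ?_ ?_ ?_ ?_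
  · rintro ⟨p, q⟩ _
    rw [Prod.swap_prod_mk, mul_comm (a q), CharTwo.add_self_eq_zero]
  · rintro ⟨p, q⟩ h _ heq
    simp only [Prod.swap_prod_mk, Prod.mk.injEq] at heq
    rw [Finset.HasAntidiagonal.mem_antidiagonal] at h
    simp only at h
    omega
  · intro p h
    rw [Finset.HasAntidiagonal.mem_antidiagonal] at h ⊢
    exact (add_comm _ _).trans h
  · intro p _
    exact p.swap_swap

theorem sum_antidiagonal_even {R : Type*} [CommRing R] [CharP R 2] (a : ℕ → R) (i : ℕ) :
    ∑ p ∈ Finset.HasAntidiagonal.antidiagonal (2 * i), a p.1 * a p.2 = a i ^ 2 := by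
  rw [← Finset.add_sum_erase _ _ (a := (i, i)) (by rw [Finset.HasAntidiagonal.mem_antidiagonal]; omega)]
  rw [Finset.sum_involution (fun p _ => p.swap), add_zero, sq]
  · rintro ⟨p, q⟩ _
    rw [Prod.swap_prod_mk, mul_comm (a q), CharTwo.add_self_eq_zero]
  · rintro ⟨p, q⟩ h _ heq
    simp only [Prod.swap_prod_mk, Prod.mk.injEq] at heq
    simp only [Finset.mem_erase, Finset.HasAntidiagonal.mem_antidiagonal, Ne, Prod.mk.injEq] at h
    omega
  · rintro ⟨p, q⟩ h
    simp only [Prod.swap_prod_mk, Finset.mem_erase, Finset.HasAntidiagonal.mem_antidiagonal, Ne,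
      Prod.mk.injEq] at h ⊢
    omega
  · intro p _
    exact p.swap_swap

section Tail

variable {k : Type*} [Field k] (f : k[X]) (n : ℕ)

/-- The element `a_i + a_{i+1} t + ⋯ + a_n t^{n-i}` of `k[T]/(f)`. -/
def tail (i : ℕ) : AdjoinRoot f :=
  ∑ j ∈ Finset.range (n + 1 - i), f.coeff (i + j) • AdjoinRoot.root f ^ j

variable {f n}

theorem tail_eq_zero {i : ℕ} (h : n < i) : tail f n i = 0 := by
  rw [tail, show n + 1 - i = 0 by omega, Finset.sum_range_zero]

variable (hdeg : f.natDegree ≤ n)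

include hdeg

theorem tail_zero : tail f n 0 = 0 := by
  have h : aeval (AdjoinRoot.root f) f = 0 := by
    rw [AdjoinRoot.aeval_eq, AdjoinRoot.mk_self]
  rw [aeval_eq_sum_range' (Nat.lt_succ_of_le hdeg)] at h
  simpa [tail] using h

theorem tail_eq (i : ℕ) : tail f n i =
    AdjoinRoot.root f * tail f n (i + 1) + algebraMap k _ (f.coeff i) := by
  by_cases h : i ≤ n
  · rw [tail, show n + 1 - i = (n + 1 - (i + 1)) + 1 by omega, Finset.sum_range_succ', tail,
      Finset.mul_sum, pow_zero, add_zero, Algebra.algebraMap_eq_smul_one]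
    congr 1
    refine Finset.sum_congr rfl fun j _ => ?_
    rw [mul_smul_comm, pow_succ', show i + (j + 1) = i + 1 + j by omega]
  · rw [tail_eq_zero (by omega), tail_eq_zero (by omega),
      coeff_eq_zero_of_natDegree_lt (by omega)]
    simp

theorem tail_last : tail f n n = algebraMap k _ (f.coeff n) := by
  rw [tail_eq hdeg, tail_eq_zero (Nat.lt_succ_self n), mul_zero, zero_add]

/-- Descending induction on `i` by the Horner recursion `tail_i = t tail_{i+1} + a_i`, which squares
termwise in characteristic two. The products `a_p a_q` that arise on antidiagonals cancel in pairs,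
except for the middle term `a_i²`. -/
theorem tail_sq [CharP k 2] [Nontrivial (AdjoinRoot f)] (i : ℕ) : tail f n i ^ 2 =
    ∑ p ∈ Finset.HasAntidiagonal.antidiagonal (2 * i), algebraMap k _ (f.coeff p.1) * tail f n p.2 := by
  have : CharP (AdjoinRoot f) 2 :=
    charP_of_injective_algebraMap (algebraMap k (AdjoinRoot f)).injective 2
  by_cases hi : n < i
  · rw [tail_eq_zero hi, zero_pow two_ne_zero]
    symm
    refine Finset.sum_eq_zero fun p hp => ?_
    rw [Finset.HasAntidiagonal.mem_antidiagonal] at hp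
    by_cases h : n < p.2
    · rw [tail_eq_zero h, mul_zero]
    · rw [coeff_eq_zero_of_natDegree_lt (by omega), map_zero, zero_mul]
  · obtain ⟨d, hd⟩ : ∃ d, d = n + 1 - i := ⟨_, rfl⟩
    induction d generalizing i with
    | zero => omega
    | succ d ih =>
      have ih' : tail f n (i + 1) ^ 2 = ∑ p ∈ Finset.HasAntidiagonal.antidiagonal (2 * (i + 1)),
          algebraMap k _ (f.coeff p.1) * tail f n p.2 := by
        by_cases h : n < i + 1
        · rw [tail_eq_zero h, zero_pow two_ne_zero]
          symm
          refine Finset.sum_eq_zero fun p hp => ?_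
          rw [Finset.HasAntidiagonal.mem_antidiagonal] at hp
          by_cases h : n < p.2
          · rw [tail_eq_zero h, mul_zero]
          · rw [coeff_eq_zero_of_natDegree_lt (by omega), map_zero, zero_mul]
        · exact ih (i + 1) h (by omega)
      set t := AdjoinRoot.root f with ht
      set a : ℕ → AdjoinRoot f := fun j => algebraMap k _ (f.coeff j) with ha
      have hrec : ∀ j, t * tail f n (j + 1) = tail f n j + a j := fun j => by
        rw [tail_eq hdeg j, add_assoc, CharTwo.add_self_eq_zero, add_zero]
      -- Multiplication by `t²` lowers the tail index by two. The antidiagonal of `2i + 2` has two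
      -- further terms, with tail indices `0` and `1`: the former vanishes as `tail_0 = f(t) = 0`,
      -- and the latter supplies the product missing from the odd antidiagonal.
      have h1 : ∀ p q, t ^ 2 * (a p * tail f n (q + 2)) =
          a p * tail f n q + a p * a q + t * (a p * a (q + 1)) := fun p q => by
        linear_combination a p * t * hrec (q + 1) + a p * hrec q
      have h2 := sum_antidiagonal_odd a i
      have h3 := sum_antidiagonal_even a i
      rw [Finset.Nat.sum_antidiagonal_succ'] at h2
      simp only at h2
      rw [tail_eq hdeg, CharTwo.add_sq, mul_pow, ih', show 2 * (i + 1) = 2 * i + 1 + 1 by ring,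
        Finset.Nat.sum_antidiagonal_succ', Finset.Nat.sum_antidiagonal_succ', tail_zero hdeg]
      simp only [mul_zero, zero_add, mul_add, Finset.mul_sum]
      rw [Finset.sum_congr rfl fun p _ => h1 p.1 p.2]
      rw [Finset.sum_add_distrib, Finset.sum_add_distrib, h3, ← Finset.mul_sum]
      have h4 := hrec 0
      rw [tail_zero hdeg, zero_add] at h4
      have h5 : a i ^ 2 + a i ^ 2 = 0 := CharTwo.add_self_eq_zero _
      linear_combination t * h2 + t * a (2 * i + 1) * h4 + h5

/-- The last tail is the unit `a_n`, so the span contains `1`; it is stable under `t` because `t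
tail_{i+1} = tail_i - a_i`. Hence it contains all powers of `t`. -/
theorem span_tail (hn : f.coeff n ≠ 0) :
    ⊤ ≤ Submodule.span k (Set.range fun i : Fin n => tail f n (i + 1)) := by
  set S := Submodule.span k (Set.range fun i : Fin n => tail f n (i + 1)) with hS
  have hmem : ∀ i, tail f n i ∈ S := by
    intro i
    rcases i with _ | i
    · rw [tail_zero hdeg]; exact S.zero_mem
    · by_cases h : i < n
      · exact Submodule.subset_span ⟨⟨i, h⟩, rfl⟩
      · rw [tail_eq_zero (by omega)]; exact S.zero_mem
  have hone : (1 : AdjoinRoot f) ∈ S := by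
    have h1 : (1 : AdjoinRoot f) = (f.coeff n)⁻¹ • tail f n n := by
      rw [tail_last hdeg, Algebra.algebraMap_eq_smul_one, smul_smul, inv_mul_cancel₀ hn, one_smul]
    rw [h1]
    exact S.smul_mem _ (hmem n)
  have hroot : ∀ x ∈ S, AdjoinRoot.root f * x ∈ S := by
    intro x hx
    induction hx using Submodule.span_induction with
    | mem x hx =>
      obtain ⟨i, rfl⟩ := hx
      have h1 : AdjoinRoot.root f * tail f n (i + 1) =
          tail f n i - f.coeff i • (1 : AdjoinRoot f) := by
        rw [tail_eq hdeg (i : ℕ), ← Algebra.algebraMap_eq_smul_one]; ring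
      exact h1 ▸ S.sub_mem (hmem i) (S.smul_mem _ hone)
    | zero => rw [mul_zero]; exact S.zero_mem
    | add x y _ _ hx hy => rw [mul_add]; exact S.add_mem hx hy
    | smul c x _ hx => rw [mul_smul_comm]; exact S.smul_mem c hx
  have hpow : ∀ j : ℕ, AdjoinRoot.root f ^ j ∈ S := by
    intro j
    induction j with
    | zero => rw [pow_zero]; exact hone
    | succ j ih => rw [pow_succ']; exact hroot _ ih
  intro x _
  obtain ⟨p, rfl⟩ := AdjoinRoot.mk_surjective x
  rw [← AdjoinRoot.aeval_eq, aeval_eq_sum_range]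
  exact S.sum_mem fun j _ => S.smul_mem _ (hpow j)

theorem finrank_adjoinRoot_of_coeff_ne_zero (hn : f.coeff n ≠ 0) :
    Module.finrank k (AdjoinRoot f) = n := by
  have h0 : f ≠ 0 := by rintro rfl; exact hn (coeff_zero n)
  rw [(AdjoinRoot.powerBasis h0).finrank, AdjoinRoot.powerBasis_dim]
  exact le_antisymm hdeg (le_natDegree_of_ne_zero hn)

/-- The basis of `k[T]/(f)` formed by the tails of `f`. -/
def tailBasis (hn : f.coeff n ≠ 0) : Module.Basis (Fin n) k (AdjoinRoot f) :=
  Module.Basis.mk (linearIndependent_of_top_le_span_of_card_eq_finrank (span_tail hdeg hn)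
    (by rw [finrank_adjoinRoot_of_coeff_ne_zero hdeg hn, Fintype.card_fin])) (span_tail hdeg hn)

theorem tailBasis_apply (hn : f.coeff n ≠ 0) (i : Fin n) :
    tailBasis hdeg hn i = tail f n (i + 1) := by
  rw [tailBasis, Module.Basis.mk_apply]

theorem nontrivial_adjoinRoot_of_coeff_ne_zero (hn : f.coeff n ≠ 0) (hpos : 0 < n) :
    Nontrivial (AdjoinRoot f) :=
  Module.nontrivial_of_finrank_pos (R := k)
    (by rw [finrank_adjoinRoot_of_coeff_ne_zero hdeg hn]; exact hpos)

omit hdeg in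
variable (f n) in
/-- The `r`-th coordinate of the square of `∑ s_i d_i` in the basis of the `d_i`. -/
def sqCoord (s : ℕ → k) (r : ℕ) : k :=
  ∑ i ∈ Finset.range n, if r ≤ 2 * i + 1 then f.coeff (2 * i + 1 - r) * s i ^ 2 else 0

/-- This rewrites `d_i²` in terms of the `d_r = tail_{r+1}` with `r < n`: the term with `tail_0`
drops out, and tails of index above `n` are zero. -/
theorem sum_antidiagonal_tail (i : ℕ) :
    ∑ p ∈ Finset.HasAntidiagonal.antidiagonal (2 * (i + 1)), algebraMap k _ (f.coeff p.1) * tail f n p.2 =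
    ∑ r ∈ Finset.range n,
      (if r ≤ 2 * i + 1 then f.coeff (2 * i + 1 - r) else 0) • tail f n (r + 1) := by
  have h1 : ∑ p ∈ Finset.HasAntidiagonal.antidiagonal (2 * (i + 1)),
      algebraMap k _ (f.coeff p.1) * tail f n p.2 =
      ∑ r ∈ Finset.range (2 * i + 2), f.coeff (2 * i + 1 - r) • tail f n (r + 1) := by
    rw [show 2 * (i + 1) = 2 * i + 1 + 1 by ring, Finset.Nat.sum_antidiagonal_succ',
      tail_zero hdeg, mul_zero, ← Finset.Nat.sum_antidiagonal_swap]
    have := Finset.Nat.sum_antidiagonal_eq_sum_range_succ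
      (fun p q => algebraMap k (AdjoinRoot f) (f.coeff q) * tail f n (p + 1)) (2 * i + 1)
    simp only [Prod.fst_swap, Prod.snd_swap]
    rw [this, zero_add]
    exact Finset.sum_congr rfl fun r _ => by rw [Algebra.smul_def]
  rw [h1]
  have h2 : ∀ r, f.coeff (2 * i + 1 - r) • tail f n (r + 1) =
      f.coeff (2 * i + 1 - r) • (if r < n then tail f n (r + 1) else 0) := by
    intro r
    split_ifs with h
    · rfl
    · rw [tail_eq_zero (by omega)]
  rw [Finset.sum_congr rfl fun r _ => h2 r]
  simp only [smul_ite, smul_zero, ite_smul, zero_smul]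
  rw [← Finset.sum_filter, ← Finset.sum_filter]
  refine Finset.sum_congr ?_ fun _ _ => rfl
  ext r
  simp only [Finset.mem_filter, Finset.mem_range]
  omega

theorem sum_tail_sq [CharP k 2] [Nontrivial (AdjoinRoot f)] (s : ℕ → k) :
    (∑ i ∈ Finset.range n, s i • tail f n (i + 1)) ^ 2 =
      ∑ r ∈ Finset.range n, sqCoord f n s r • tail f n (r + 1) := by
  have : CharP (AdjoinRoot f) 2 :=
    charP_of_injective_algebraMap (algebraMap k (AdjoinRoot f)).injective 2
  rw [CharTwo.sum_sq]
  simp only [sqCoord, Finset.sum_smul]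
  rw [Finset.sum_comm]
  refine Finset.sum_congr rfl fun i _ => ?_
  rw [_root_.smul_pow, tail_sq hdeg, sum_antidiagonal_tail hdeg, Finset.smul_sum]
  refine Finset.sum_congr rfl fun r _ => ?_
  split_ifs
  · rw [smul_smul, mul_comm]
  · rw [zero_smul, smul_zero]

theorem sum_tail_inj (hn : f.coeff n ≠ 0) (s s' : ℕ → k)
    (h : ∑ i ∈ Finset.range n, s i • tail f n (i + 1) =
      ∑ i ∈ Finset.range n, s' i • tail f n (i + 1)) {r : ℕ} (hr : r < n) : s r = s' r := by
  rw [Finset.sum_range, Finset.sum_range] at h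
  simp only [← tailBasis_apply hdeg hn] at h
  have := congrArg (fun x => (tailBasis hdeg hn).repr x ⟨r, hr⟩) h
  simpa only [Module.Basis.repr_sum_self] using this

theorem isIdempotentElem_sum_tail_iff [CharP k 2] [Nontrivial (AdjoinRoot f)]
    (hn : f.coeff n ≠ 0) (s : ℕ → k) :
    IsIdempotentElem (∑ i ∈ Finset.range n, s i • tail f n (i + 1)) ↔
      ∀ r < n, s r = sqCoord f n s r := by
  rw [IsIdempotentElem, ← sq, sum_tail_sq hdeg]
  constructor
  · intro h r hr
    exact (sum_tail_inj hdeg hn _ _ h hr).symm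
  · intro h
    exact Finset.sum_congr rfl fun r hr => by rw [← h r (Finset.mem_range.1 hr)]

end Tail

/-- An Artin–Schreier equation over `k` that is solvable in an algebra of odd dimension is
solvable in `k`. -/
theorem exists_artinSchreier_root {k A : Type*} [Field k] [CommRing A] [Algebra k A]
    (hodd : Odd (Module.finrank k A)) (u : A) (c : k) (hu : u ^ 2 + u = algebraMap k A c) :
    ∃ x : k, x ^ 2 + x = c := by
  by_contra! hno
  set P : k[X] := X ^ 2 + X - C c with hP
  have hPdeg : P.natDegree = 2 := by rw [hP]; compute_degree!
  -- A quadratic polynomial without roots is irreducible, and `u` then makes `A` a vector space over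
  -- the quadratic extension `k[X]/(P)`, so that its dimension over `k` is even.
  have hirr : Irreducible P := by
    rw [irreducible_iff_roots_eq_zero_of_degree_le_three (by omega) (by omega),
      Multiset.eq_zero_iff_forall_notMem]
    intro x hx
    have := (mem_roots'.1 hx).2
    simp only [hP, IsRoot.def, eval_sub, eval_add, eval_pow, eval_X, eval_C] at this
    exact hno x (sub_eq_zero.1 this)
  have : Fact (Irreducible P) := ⟨hirr⟩
  let φ : AdjoinRoot P →ₐ[k] A := AdjoinRoot.liftAlgHom P (Algebra.ofId k A) u (by
    simp [hP, hu])
  let _ : Algebra (AdjoinRoot P) A := φ.toRingHom.toAlgebra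
  have : IsScalarTower k (AdjoinRoot P) A := IsScalarTower.of_algebraMap_eq fun x =>
    (φ.commutes x).symm
  have h1 := Module.finrank_mul_finrank k (AdjoinRoot P) A
  rw [(AdjoinRoot.powerBasis hirr.ne_zero).finrank, AdjoinRoot.powerBasis_dim, hPdeg] at h1
  rw [← h1] at hodd
  exact (Nat.not_odd_iff_even.2 (even_two_mul _)) hodd

end QuadPencil

end

/-! ### Unipotent Hankel endomorphisms -/

noncomputable section

namespace QuadPencil

variable {k : Type*} [Field k] {E : Type*} [AddCommGroup E] [Module k E] {m : ℕ}
  {e : Module.Basis (Fin (2 * m + 1)) k E} {q₀ q₁ : QuadraticForm k E}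

theorem dElem_eq_tail (i : ℕ) :
    dElem e q₀ q₁ i = tail (dehomHalfDisc e q₀ q₁) (2 * m + 1) (i + 1) := by
  rw [dElem, tail, Nat.succ_sub_succ]

theorem map_sum_of_isotropic (q : QuadraticForm k E) (w : ℕ → E)
    (hw : ∀ i j, QuadraticMap.polar q (w i) (w j) = 0) (c : ℕ → k) (N : ℕ) :
    q (∑ j ∈ Finset.range N, c j • w j) = ∑ j ∈ Finset.range N, q (w j) * c j ^ 2 := by
  induction N with
  | zero => simp
  | succ N ih =>
    have h : QuadraticMap.polar q (∑ j ∈ Finset.range N, c j • w j) (c N • w N) = 0 := by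
      rw [QuadraticMap.polar_comm, polar_sum_right]
      exact Finset.sum_eq_zero fun j _ => by
        rw [QuadraticMap.polar_smul_left, QuadraticMap.polar_smul_right, hw, smul_zero, smul_zero]
    rw [Finset.sum_range_succ, QuadraticMap.map_add q, h, ih, QuadraticMap.map_smul,
      Finset.sum_range_succ, add_zero, smul_eq_mul]
    ring

section Hankel

variable (B : Module.Basis (Fin (m + 1) ⊕ Fin m) k E) (w : ℕ → E)

/-- The nilpotent endomorphism given in a Kronecker basis by the Hankel matrix of `s`. -/
def hankelMap (s : ℕ → k) : E →ₗ[k] E :=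
  B.constr k (Sum.elim (fun _ => 0) fun i : Fin m =>
    ∑ j ∈ Finset.range (m + 1), s ((i : ℕ) + j) • w j)

theorem hankelMap_inl (s : ℕ → k) (i : Fin (m + 1)) : hankelMap B w s (B (.inl i)) = 0 := by
  rw [hankelMap, B.constr_basis, Sum.elim_inl]

theorem hankelMap_inr (s : ℕ → k) (i : Fin m) : hankelMap B w s (B (.inr i)) =
    ∑ j ∈ Finset.range (m + 1), s ((i : ℕ) + j) • w j := by
  rw [hankelMap, B.constr_basis, Sum.elim_inr]

theorem hankelMap_add (s s' : ℕ → k) :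
    hankelMap B w (s + s') = hankelMap B w s + hankelMap B w s' := by
  refine B.ext ?_
  rintro (i | i)
  · simp [hankelMap_inl]
  · simp [hankelMap_inr, add_smul, Finset.sum_add_distrib]

variable {B w} (hBw : ∀ i : Fin (m + 1), B (.inl i) = w i)
include hBw

theorem hankelMap_apply_w (s : ℕ → k) {j : ℕ} (hj : j ∈ Finset.range (m + 1)) :
    hankelMap B w s (w j) = 0 := by
  have := hankelMap_inl B w s ⟨j, Finset.mem_range.1 hj⟩
  rwa [hBw] at this

theorem hankelMap_hankelMap (s s' : ℕ → k) (x : E) :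
    hankelMap B w s (hankelMap B w s' x) = 0 := by
  have h : hankelMap B w s ∘ₗ hankelMap B w s' = 0 := by
    refine B.ext ?_
    rintro (i | i)
    · simp [hankelMap_inl]
    · rw [LinearMap.comp_apply, hankelMap_inr, map_sum]
      exact Finset.sum_eq_zero fun j hj => by
        rw [map_smul, hankelMap_apply_w hBw s hj, smul_zero]
  exact LinearMap.congr_fun h x

variable [CharP k 2]

omit hBw [CharP k 2] in
theorem polar_inr_hankelMap_inr (q : QuadraticForm k E) {d : ℕ} (hd : d ≤ 1)
    (hvw : ∀ (l : Fin m) j, QuadraticMap.polar q (B (.inr l)) (w j) = if j = l + d then 1 else 0)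
    (s : ℕ → k) (i l : Fin m) : QuadraticMap.polar q (B (.inr i)) (hankelMap B w s (B (.inr l))) =
      s (l + (i + d)) := by
  rw [hankelMap_inr, polar_sum_right, Finset.sum_eq_single ((i : ℕ) + d)]
  · rw [QuadraticMap.polar_smul_right, hvw, if_pos rfl, smul_eq_mul, mul_one]
  · intro j _ hj
    rw [QuadraticMap.polar_smul_right, hvw, if_neg hj, smul_zero]
  · intro h
    simp only [Finset.mem_range] at h
    omega

/-- The defect `D(x) = q(Nx) + b(x, Nx)` is additive, since the image of `N` is isotropic for `b`
and the Hankel property makes `b(x, Ny)` symmetric. So `D` need only vanish on a basis; on the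
second half of `B` this is the hypothesis on `s`. The shift `d` is `0` for `q₁` and `1` for `q₀`. -/
theorem map_add_hankelMap (q : QuadraticForm k E) {d : ℕ} (hd : d ≤ 1)
    (hww : ∀ i j, QuadraticMap.polar q (w i) (w j) = 0)
    (hvw : ∀ (l : Fin m) j, QuadraticMap.polar q (B (.inr l)) (w j) = if j = l + d then 1 else 0)
    (s : ℕ → k) (hs : ∀ i < m, s (2 * i + d) =
      ∑ j ∈ Finset.range (m + 1), q (w j) * s (i + j) ^ 2) (x : E) :
    q (x + hankelMap B w s x) = q x := by
  set N := hankelMap B w s with hN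
  have hNl : ∀ i, N (B (.inl i)) = 0 := hankelMap_inl B w s
  have hwN : ∀ (i : Fin (m + 1)) l,
      QuadraticMap.polar q (B (.inl i)) (N (B (.inr l))) = 0 := by
    intro i l
    rw [hN, hankelMap_inr, polar_sum_right]
    exact Finset.sum_eq_zero fun j _ => by
      rw [QuadraticMap.polar_smul_right, hBw, hww, smul_zero]
  have hNN : ∀ x y, QuadraticMap.polar q (N x) (N y) = 0 := by
    have h : ((QuadraticMap.polarBilin q).compl₁₂ N N : LinearMap.BilinForm k E) = 0 := by
      refine LinearMap.BilinForm.ext_basis B ?_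
      rintro (i | i) (l | l)
      · simp [hNl]
      · simp [hNl]
      · simp [hNl]
      · rw [LinearMap.compl₁₂_apply, QuadraticMap.polarBilin_apply_apply, hN, hankelMap_inr,
          QuadraticMap.polar_comm, polar_sum_right, LinearMap.zero_apply, LinearMap.zero_apply]
        refine Finset.sum_eq_zero fun j hj => ?_
        rw [QuadraticMap.polar_smul_right, QuadraticMap.polar_comm]
        have := hwN ⟨j, Finset.mem_range.1 hj⟩ l
        rw [hBw, hN] at this
        rw [this, smul_zero]
    exact fun x y => LinearMap.congr_fun₂ h x y
  have hsym : ∀ x y, QuadraticMap.polar q x (N y) + QuadraticMap.polar q y (N x) = 0 := by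
    have h : ((QuadraticMap.polarBilin q).compl₂ N + ((QuadraticMap.polarBilin q).compl₂ N).flip :
        LinearMap.BilinForm k E) = 0 := by
      refine LinearMap.BilinForm.ext_basis B ?_
      rintro (i | i) (l | l)
      · simp [hNl]
      · simp [hNl, hwN]
      · simp [hNl, hwN]
      · simp only [LinearMap.add_apply, LinearMap.flip_apply, LinearMap.compl₂_apply,
          QuadraticMap.polarBilin_apply_apply, LinearMap.zero_apply, hN,
          polar_inr_hankelMap_inr q hd hvw]
        rw [show (l : ℕ) + (i + d) = i + (l + d) by omega, CharTwo.add_self_eq_zero]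
    exact fun x y => LinearMap.congr_fun₂ h x y
  have hD : ∀ x, q (N x) + QuadraticMap.polar q x (N x) = 0 := by
    intro x
    have hx : x ∈ Submodule.span k (Set.range B) := by rw [B.span_eq]; trivial
    induction hx using Submodule.span_induction with
    | mem x hx =>
      obtain ⟨i | i, rfl⟩ := hx
      · rw [hNl, QuadraticMap.map_zero, QuadraticMap.polar_zero_right, add_zero]
      · rw [hN, polar_inr_hankelMap_inr q hd hvw, hankelMap_inr, map_sum_of_isotropic q w hww,
          ← add_assoc, ← two_mul, hs i i.2, CharTwo.add_self_eq_zero]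
    | zero => rw [map_zero, QuadraticMap.map_zero, QuadraticMap.polar_zero_right, add_zero]
    | add x y _ _ hx hy =>
      rw [map_add, QuadraticMap.map_add q, hNN, QuadraticMap.polar_add_left,
        QuadraticMap.polar_add_right, QuadraticMap.polar_add_right]
      linear_combination hx + hy + hsym x y
    | smul c x _ hx =>
      rw [map_smul, QuadraticMap.map_smul, QuadraticMap.polar_smul_left,
        QuadraticMap.polar_smul_right, smul_eq_mul, smul_eq_mul, smul_eq_mul]
      linear_combination c * c * hx
  rw [QuadraticMap.map_add q, add_assoc, hD, add_zero]

/-- The unipotent automorphism `1 + N` with `N` the Hankel endomorphism of `s`. -/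
def hankelEquiv (hBw : ∀ i : Fin (m + 1), B (.inl i) = w i) (s : ℕ → k) : E ≃ₗ[k] E :=
  LinearEquiv.ofLinearMap (LinearMap.id + hankelMap B w s) (LinearMap.id + hankelMap B w s)
    (by
      ext x
      have h : hankelMap B w s x + hankelMap B w s x = 0 := by
        rw [← two_smul k, CharTwo.two_eq_zero, zero_smul]
      simp [hankelMap_hankelMap hBw, add_assoc, h])
    (by
      ext x
      have h : hankelMap B w s x + hankelMap B w s x = 0 := by
        rw [← two_smul k, CharTwo.two_eq_zero, zero_smul]
      simp [hankelMap_hankelMap hBw, add_assoc, h])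

theorem hankelEquiv_apply (s : ℕ → k) (x : E) :
    hankelEquiv hBw s x = x + hankelMap B w s x := rfl

theorem hankelEquiv_add (s s' : ℕ → k) :
    hankelEquiv hBw (s + s') = hankelEquiv hBw s * hankelEquiv hBw s' := by
  ext x
  rw [LinearEquiv.mul_apply]
  simp only [hankelEquiv_apply, hankelMap_add, map_add, hankelMap_hankelMap hBw,
    LinearMap.add_apply]
  abel

end Hankel

variable [CharP k 2]

/-- With `a_{2j+1} = q₁(w_j)`, the even coordinates of a square are the sums in the invariance
condition for `q₁`; the odd ones correspond to `q₀` in the same way. -/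
theorem sqCoord_even {i : ℕ} (hi : i ≤ m) (s : ℕ → k) :
    sqCoord (dehomHalfDisc e q₀ q₁) (2 * m + 1) s (2 * i) =
      ∑ j ∈ Finset.range (m + 1), q₁ (radVec e q₀ q₁ j) * s (i + j) ^ 2 := by
  rw [sqCoord, ← Finset.sum_filter]
  have h : ∀ j, q₁ (radVec e q₀ q₁ j) * s (i + j) ^ 2 =
      (dehomHalfDisc e q₀ q₁).coeff (2 * (i + j) + 1 - 2 * i) * s (i + j) ^ 2 := fun j => by
    rw [← coeff_dehomHalfDisc_odd, show 2 * (i + j) + 1 - 2 * i = 2 * j + 1 by omega]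
  rw [Finset.sum_congr rfl fun j _ => h j]
  have h2 := Finset.sum_Ico_eq_sum_range (fun l => (dehomHalfDisc e q₀ q₁).coeff
    (2 * l + 1 - 2 * i) * s l ^ 2) i (i + (m + 1))
  rw [Nat.add_sub_cancel_left] at h2
  rw [← h2]
  symm
  refine Finset.sum_subset ?_ ?_
  · intro l
    simp only [Finset.mem_Ico, Finset.mem_filter, Finset.mem_range]
    omega
  · intro l h3 h4
    simp only [Finset.mem_Ico, Finset.mem_filter, Finset.mem_range] at h3 h4
    rw [coeff_eq_zero_of_natDegree_lt, zero_mul]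
    have := natDegree_dehomHalfDisc_le e q₀ q₁
    omega

theorem sqCoord_odd {i : ℕ} (hi : i ≤ m) (s : ℕ → k) :
    sqCoord (dehomHalfDisc e q₀ q₁) (2 * m + 1) s (2 * i + 1) =
      ∑ j ∈ Finset.range (m + 1), q₀ (radVec e q₀ q₁ j) * s (i + j) ^ 2 := by
  rw [sqCoord, ← Finset.sum_filter]
  have h : ∀ j, q₀ (radVec e q₀ q₁ j) * s (i + j) ^ 2 =
      (dehomHalfDisc e q₀ q₁).coeff (2 * (i + j) + 1 - (2 * i + 1)) * s (i + j) ^ 2 := fun j => by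
    rw [← coeff_dehomHalfDisc_even, show 2 * (i + j) + 1 - (2 * i + 1) = 2 * j by omega]
  rw [Finset.sum_congr rfl fun j _ => h j]
  have h2 := Finset.sum_Ico_eq_sum_range (fun l => (dehomHalfDisc e q₀ q₁).coeff
    (2 * l + 1 - (2 * i + 1)) * s l ^ 2) i (i + (m + 1))
  rw [Nat.add_sub_cancel_left] at h2
  rw [← h2]
  symm
  refine Finset.sum_subset ?_ ?_
  · intro l
    simp only [Finset.mem_Ico, Finset.mem_filter, Finset.mem_range]
    omega
  · intro l h3 h4
    simp only [Finset.mem_Ico, Finset.mem_filter, Finset.mem_range] at h3 h4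
    have := natDegree_dehomHalfDisc_le e q₀ q₁
    by_cases h5 : l = i + m + 1
    -- This boundary index involves `a_{2m+2} = q₀(w_{m+1})`, which is zero because `w_{m+1} = 0`.
    · rw [h5, show 2 * (i + m + 1) + 1 - (2 * i + 1) = 2 * (m + 1) by omega,
        coeff_dehomHalfDisc_even, radVec_eq_zero e q₀ q₁ (by omega), QuadraticMap.map_zero, zero_mul]
    · rw [coeff_eq_zero_of_natDegree_lt, zero_mul]
      omega

namespace IsKroneckerBasis

variable {B : Module.Basis (Fin (m + 1) ⊕ Fin m) k E} (hB : IsKroneckerBasis e q₀ q₁ B)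
include hB

omit [CharP k 2] in
theorem inl_eq (i : Fin (m + 1)) : B (.inl i) = radVec e q₀ q₁ i := by
  rw [hB.normalized, radicalVector_eq]

omit [CharP k 2] in
theorem polar_one_inr (l : Fin m) (j : ℕ) :
    QuadraticMap.polar q₁ (B (.inr l)) (radVec e q₀ q₁ j) = if j = l + 0 then 1 else 0 := by
  by_cases hj : j < m + 1
  · have := hB.wv₁ ⟨j, hj⟩ l
    rw [hB.inl_eq] at this
    rw [QuadraticMap.polar_comm, this]
    simp [Fin.ext_iff]
  · rw [radVec_eq_zero e q₀ q₁ (by omega), QuadraticMap.polar_zero_right, if_neg (by omega)]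

omit [CharP k 2] in
theorem polar_zero_inr (l : Fin m) (j : ℕ) :
    QuadraticMap.polar q₀ (B (.inr l)) (radVec e q₀ q₁ j) = if j = l + 1 then 1 else 0 := by
  by_cases hj : j < m + 1
  · have := hB.wv₀ ⟨j, hj⟩ l
    rw [hB.inl_eq] at this
    rw [QuadraticMap.polar_comm, this]
    simp [Fin.ext_iff]
  · rw [radVec_eq_zero e q₀ q₁ (by omega), QuadraticMap.polar_zero_right, if_neg (by omega)]

omit [CharP k 2] in
theorem repr_inr (x : E) (l : Fin m) :
    B.repr x (.inr l) = QuadraticMap.polar q₁ (B (.inl l.castSucc)) x := by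
  conv_rhs => rw [← B.sum_repr x, Fintype.sum_sum_type, QuadraticMap.polar_add_right,
    polar_sum_right, polar_sum_right]
  simp [QuadraticMap.polar_smul_right, hB.ww₁, hB.wv₁]

omit [CharP k 2] in
/-- The span of the radical vectors is its own orthogonal complement. -/
theorem eq_sum_inl (x : E)
    (hx : ∀ l : Fin m, QuadraticMap.polar q₁ (B (.inl l.castSucc)) x = 0) :
    x = ∑ j : Fin (m + 1), B.repr x (.inl j) • B (.inl j) := by
  conv_lhs => rw [← B.sum_repr x, Fintype.sum_sum_type]
  simp [hB.repr_inr, hx]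

theorem hankelEquiv_mem_pairAut (s : ℕ → k)
    (hs : ∀ r < 2 * m, s r = sqCoord (dehomHalfDisc e q₀ q₁) (2 * m + 1) s r) :
    hankelEquiv hB.inl_eq s ∈ pairAut q₀ q₁ := by
  constructor
  · intro x
    rw [hankelEquiv_apply]
    refine map_add_hankelMap hB.inl_eq q₀ le_rfl (polar_zero_radVec_radVec e q₀ q₁)
      hB.polar_zero_inr s (fun i hi => ?_) x
    rw [hs _ (by omega), sqCoord_odd hi.le]
  · intro x
    rw [hankelEquiv_apply]
    refine map_add_hankelMap hB.inl_eq q₁ zero_le_one (polar_one_radVec_radVec e q₀ q₁)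
      hB.polar_one_inr s (fun i hi => ?_) x
    rw [add_zero, hs _ (by omega), sqCoord_even hi.le]

end IsKroneckerBasis

end QuadPencil

end

/-! ### Automorphisms of the pair are Hankel -/

noncomputable section

namespace QuadPencil

variable {k : Type*} [Field k] [CharP k 2] {E : Type*} [AddCommGroup E] [Module k E] {m : ℕ}
  {e : Module.Basis (Fin (2 * m + 1)) k E} {q₀ q₁ : QuadraticForm k E}

omit [CharP k 2] in
theorem polar_map_of_isometry {q : QuadraticForm k E} {g : E ≃ₗ[k] E} (hg : ∀ v, q (g v) = q v)
    (x y : E) : QuadraticMap.polar q (g x) (g y) = QuadraticMap.polar q x y := by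
  simp only [QuadraticMap.polar, ← map_add, hg]

omit [CharP k 2] in
theorem polar_map_right_of_isometry {q : QuadraticForm k E} {g : E ≃ₗ[k] E}
    (hg : ∀ v, q (g v) = q v) (x y : E) :
    QuadraticMap.polar q x (g y) = QuadraticMap.polar q (g.symm x) y := by
  rw [← polar_map_of_isometry hg (g.symm x), LinearEquiv.apply_symm_apply]

theorem radVec_ne_zero (hn : (dehomHalfDisc e q₀ q₁).coeff (2 * m + 1) ≠ 0) :
    radVec e q₀ q₁ m ≠ 0 := by
  intro h
  rw [coeff_dehomHalfDisc_odd, h, QuadraticMap.map_zero] at hn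
  exact hn rfl

/-- Automorphisms of the pair fix the radical map. -/
theorem map_radVec (hreg : IsRegularPair e q₀ q₁)
    (hn : (dehomHalfDisc e q₀ q₁).coeff (2 * m + 1) ≠ 0) {g : E ≃ₗ[k] E}
    (hg : g ∈ pairAut q₀ q₁) (s : ℕ) : g (radVec e q₀ q₁ s) = radVec e q₀ q₁ s := by
  obtain ⟨c, hc⟩ := exists_eq_smul_radVec e q₀ q₁ hreg (radVec_ne_zero hn)
    (fun s => g (radVec e q₀ q₁ s))
    (fun s hs => by rw [radVec_eq_zero e q₀ q₁ hs, map_zero])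
    (fun x => by rw [polar_map_right_of_isometry hg.1, polar_radVec_zero])
    (fun s x => by rw [polar_map_right_of_isometry hg.1, polar_map_right_of_isometry hg.2,
      polar_radVec_succ])
  -- The factor `c` is determined by `q₁(w_m) = a_n ≠ 0`: invariance gives `c² = 1`, and `1` is the
  -- only square root of `1` in characteristic two.
  have h1 := hg.2 (radVec e q₀ q₁ m)
  rw [hc m, QuadraticMap.map_smul, smul_eq_mul] at h1
  rw [coeff_dehomHalfDisc_odd] at hn
  have h2 : c * c = 1 := mul_right_cancel₀ hn (by rw [h1, one_mul])
  have h3 : (c + 1) * (c + 1) = 0 := by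
    linear_combination h2 + CharTwo.add_self_eq_zero c + CharTwo.add_self_eq_zero (1 : k)
  have h4 : c = 1 := by
    rw [← sub_eq_zero, CharTwo.sub_eq_add]
    exact mul_self_eq_zero.1 h3
  rw [hc s, h4, one_smul]

/-- A matrix with the symmetries of a Hankel matrix is a Hankel matrix. -/
theorem hankel_of_symm {R : Type*} (K : ℕ → ℕ → R) (h₁ : ∀ i < m, ∀ l < m, K i l = K l i)
    (h₀ : ∀ i < m, ∀ l < m, K i (l + 1) = K l (i + 1)) :
    ∀ i < m, ∀ j ≤ m, K i j = K (i + j - m) (min (i + j) m) := by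
  intro i
  induction i with
  | zero =>
    intro _ j hj
    rw [Nat.zero_add, Nat.sub_eq_zero_of_le hj, min_eq_left hj]
  | succ i ih =>
    intro hi j hj
    rcases hj.lt_or_eq with hj | rfl
    -- The two symmetries combine to `K (i+1) j = K i (j+1)`, one step along an antidiagonal.
    · rw [h₁ (i + 1) hi j hj, ← h₀ i (by omega) j hj, ih (by omega) (j + 1) (by omega),
        show i + (j + 1) = i + 1 + j by omega]
    · rw [Nat.add_sub_cancel, min_eq_right (by omega)]

namespace IsKroneckerBasis

variable {B : Module.Basis (Fin (m + 1) ⊕ Fin m) k E} (hB : IsKroneckerBasis e q₀ q₁ B)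
include hB

/-- Every automorphism of the pair is unipotent with a Hankel matrix. -/
theorem exists_eq_hankelEquiv (hreg : IsRegularPair e q₀ q₁)
    (hn : (dehomHalfDisc e q₀ q₁).coeff (2 * m + 1) ≠ 0) {g : E ≃ₗ[k] E}
    (hg : g ∈ pairAut q₀ q₁) : ∃ s : ℕ → k,
      (∀ r < 2 * m, s r = sqCoord (dehomHalfDisc e q₀ q₁) (2 * m + 1) s r) ∧
      g = hankelEquiv hB.inl_eq s := by
  have hgw := map_radVec hreg hn hg
  set w := radVec e q₀ q₁ with hw
  let u : Fin m → E := fun i => g (B (.inr i)) - B (.inr i)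
  have hgv : ∀ i, g (B (.inr i)) = B (.inr i) + u i := fun i => by simp [u]
  -- Since `g` fixes the `w_l`, the displacement `u i` is orthogonal to them, hence lies in their
  -- span by `eq_sum_inl`.
  have hwu : ∀ (l : Fin m) i, QuadraticMap.polar q₁ (B (.inl l.castSucc)) (u i) = 0 := by
    intro l i
    have h1 := polar_map_of_isometry hg.2 (B (.inl l.castSucc)) (B (.inr i))
    rw [hB.inl_eq, hgw, hgv, QuadraticMap.polar_add_right, add_eq_left] at h1
    rw [hB.inl_eq, h1]
  let K : ℕ → ℕ → k := fun i j => if hi : i < m then if hj : j < m + 1 then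
    B.repr (u ⟨i, hi⟩) (.inl ⟨j, hj⟩) else 0 else 0
  have hu : ∀ i : Fin m, u i = ∑ j ∈ Finset.range (m + 1), K i j • w j := by
    intro i
    rw [hB.eq_sum_inl (u i) fun l => hwu l i, Finset.sum_range]
    refine Finset.sum_congr rfl fun j _ => ?_
    rw [hB.inl_eq]
    congr 1
    simp only [K, dif_pos i.2, dif_pos j.2]
  have hvu : ∀ (q : QuadraticForm k E) (d : ℕ), d ≤ 1 →
      (∀ (l : Fin m) j, QuadraticMap.polar q (B (.inr l)) (w j) = if j = l + d then 1 else 0) →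
      ∀ i l : Fin m, QuadraticMap.polar q (B (.inr i)) (u l) = K l (i + d) := by
    intro q d hd hq i l
    rw [hu, polar_sum_right, Finset.sum_eq_single ((i : ℕ) + d)]
    · rw [QuadraticMap.polar_smul_right, hq, if_pos rfl, smul_eq_mul, mul_one]
    · intro j _ hj
      rw [QuadraticMap.polar_smul_right, hq, if_neg hj, smul_zero]
    · intro h
      simp only [Finset.mem_range] at h
      omega
  have huu : ∀ (q : QuadraticForm k E), (∀ i j, QuadraticMap.polar q (w i) (w j) = 0) →
      ∀ i l, QuadraticMap.polar q (u i) (u l) = 0 := by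
    intro q hq i l
    rw [hu l, polar_sum_right]
    refine Finset.sum_eq_zero fun j _ => ?_
    rw [QuadraticMap.polar_smul_right, QuadraticMap.polar_comm, hu i, polar_sum_right,
      Finset.sum_eq_zero, smul_zero]
    intro a _
    rw [QuadraticMap.polar_smul_right, hq, smul_zero]
  -- Invariance of the polar form on pairs of `v`'s gives a symmetry of the matrix `K`; invariance
  -- of `q` on each `v` gives a quadratic equation for its entries.
  have hK : ∀ (q : QuadraticForm k E) (d : ℕ), d ≤ 1 → (∀ v, q (g v) = q v) →
      (∀ i j, QuadraticMap.polar q (w i) (w j) = 0) →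
      (∀ (l : Fin m) j, QuadraticMap.polar q (B (.inr l)) (w j) = if j = l + d then 1 else 0) →
      (∀ i < m, ∀ l < m, K i (l + d) = K l (i + d)) ∧
      ∀ i < m, K i (i + d) = ∑ j ∈ Finset.range (m + 1), q (w j) * K i j ^ 2 := by
    intro q d hd hgq hww hvw
    constructor
    · intro i hi l hl
      have h1 := polar_map_of_isometry hgq (B (.inr ⟨i, hi⟩)) (B (.inr ⟨l, hl⟩))
      rw [hgv, hgv, QuadraticMap.polar_add_left, QuadraticMap.polar_add_right,
        QuadraticMap.polar_add_right, huu q hww, QuadraticMap.polar_comm q (u ⟨i, hi⟩),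
        hvu q d hd hvw, hvu q d hd hvw, add_zero, add_assoc, add_eq_left] at h1
      rw [← sub_eq_zero, CharTwo.sub_eq_add, add_comm]
      exact h1
    · intro i hi
      have h1 := hgq (B (.inr ⟨i, hi⟩))
      rw [hgv, QuadraticMap.map_add q, hvu q d hd hvw, add_assoc, add_eq_left, hu,
        map_sum_of_isotropic q w hww] at h1
      rw [← sub_eq_zero, CharTwo.sub_eq_add, add_comm]
      exact h1
  have hK₁ := hK q₁ 0 zero_le_one hg.2 (polar_one_radVec_radVec e q₀ q₁) hB.polar_one_inr
  have hK₀ := hK q₀ 1 le_rfl hg.1 (polar_zero_radVec_radVec e q₀ q₁) hB.polar_zero_inr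
  have hankel := hankel_of_symm K hK₁.1 hK₀.1
  -- The representative of the antidiagonal `i + j = c` is taken in row `0` for `c ≤ m` and in
  -- column `m` afterwards.
  let s : ℕ → k := fun c => K (c - m) (min c m)
  have hs : ∀ i < m, ∀ j ≤ m, K i j = s (i + j) := hankel
  refine ⟨s, ?_, ?_⟩
  · intro r hr
    obtain ⟨i, rfl | rfl⟩ := r.even_or_odd'
    · have hi : i < m := by omega
      rw [sqCoord_even hi.le, two_mul, ← hs i hi i hi.le]
      refine (hK₁.2 i hi).trans (Finset.sum_congr rfl fun j hj => ?_)
      rw [hs i hi j (Nat.lt_succ_iff.1 (Finset.mem_range.1 hj))]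
    · have hi : i < m := by omega
      rw [sqCoord_odd hi.le, two_mul, add_assoc, ← hs i hi (i + 1) hi]
      refine (hK₀.2 i hi).trans (Finset.sum_congr rfl fun j hj => ?_)
      rw [hs i hi j (Nat.lt_succ_iff.1 (Finset.mem_range.1 hj))]
  · refine B.ext' ?_
    rintro (i | i)
    · rw [hankelEquiv_apply, hankelMap_inl, add_zero, hB.inl_eq, hgw]
    · rw [hankelEquiv_apply, hankelMap_inr, hgv, hu]
      congr 1
      refine Finset.sum_congr rfl fun j hj => ?_
      rw [hs i i.2 j (Nat.lt_succ_iff.1 (Finset.mem_range.1 hj))]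

theorem hankelEquiv_congr {s s' : ℕ → k} (h : ∀ r < 2 * m, s r = s' r) :
    hankelEquiv hB.inl_eq s = hankelEquiv hB.inl_eq s' := by
  refine B.ext' ?_
  rintro (i | i)
  · rw [hankelEquiv_apply, hankelEquiv_apply, hankelMap_inl, hankelMap_inl]
  · rw [hankelEquiv_apply, hankelEquiv_apply, hankelMap_inr, hankelMap_inr]
    congr 1
    refine Finset.sum_congr rfl fun j hj => ?_
    rw [h _ (by have := i.2; have := Finset.mem_range.1 hj; omega)]

theorem eq_zero_of_hankelEquiv_eq_one {s : ℕ → k} (h : hankelEquiv hB.inl_eq s = 1) :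
    ∀ r < 2 * m, s r = 0 := by
  have key : ∀ (i : Fin m), ∀ j ≤ m, s (i + j) = 0 := by
    intro i j hj
    have h1 : hankelEquiv hB.inl_eq s (B (.inr i)) = B (.inr i) := LinearEquiv.congr_fun h _
    rw [hankelEquiv_apply, hankelMap_inr, add_eq_left, Finset.sum_range] at h1
    simp only [← hB.inl_eq] at h1
    have hli := B.linearIndependent.comp _ Sum.inl_injective
    exact Fintype.linearIndependent_iff.1 hli _ h1 ⟨j, Nat.lt_succ_iff.2 hj⟩
  intro r hr
  by_cases h1 : r ≤ m
  · have := key ⟨0, by omega⟩ r h1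
    simpa using this
  · have := key ⟨r - m, by omega⟩ m le_rfl
    rwa [show r - m + m = r by omega] at this

end IsKroneckerBasis

end QuadPencil

end

/-! ### The isomorphism between idempotents modulo constants and automorphisms -/

noncomputable section

namespace QuadPencil

variable {k : Type*} [Field k] [CharP k 2] {E : Type*} [AddCommGroup E] [Module k E] {m : ℕ}
  {e : Module.Basis (Fin (2 * m + 1)) k E} {q₀ q₁ : QuadraticForm k E}

section Coordinates

variable {f : k[X]} {n : ℕ} (hdeg : f.natDegree ≤ n) (hn : f.coeff n ≠ 0)

/-- The coordinates of an element of `k[T]/(f)` in the basis of the tails of `f`. -/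
def tailCoord (x : AdjoinRoot f) (i : ℕ) : k :=
  if h : i < n then (tailBasis hdeg hn).repr x ⟨i, h⟩ else 0

omit [CharP k 2] in
theorem eq_sum_tailCoord (x : AdjoinRoot f) :
    x = ∑ i ∈ Finset.range n, tailCoord hdeg hn x i • tail f n (i + 1) := by
  conv_lhs => rw [← (tailBasis hdeg hn).sum_repr x]
  rw [Finset.sum_range]
  refine Finset.sum_congr rfl fun i _ => ?_
  rw [tailCoord, dif_pos i.2, tailBasis_apply]

omit [CharP k 2] in
theorem tailCoord_add (x y : AdjoinRoot f) :
    tailCoord hdeg hn (x + y) = tailCoord hdeg hn x + tailCoord hdeg hn y := by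
  funext i
  simp only [tailCoord, Pi.add_apply]
  split_ifs <;> simp

omit [CharP k 2] in
theorem tailCoord_eq (s : ℕ → k) {x : AdjoinRoot f}
    (hx : x = ∑ i ∈ Finset.range n, s i • tail f n (i + 1)) {r : ℕ} (hr : r < n) :
    tailCoord hdeg hn x r = s r :=
  sum_tail_inj hdeg hn _ _ ((eq_sum_tailCoord hdeg hn x).symm.trans hx) hr

theorem tailCoord_idem (hpos : 0 < n) (ε : Idem k (AdjoinRoot f)) {r : ℕ} (hr : r < n) :
    tailCoord hdeg hn ε r = sqCoord f n (tailCoord hdeg hn ε) r := by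
  have := nontrivial_adjoinRoot_of_coeff_ne_zero hdeg hn hpos
  refine (isIdempotentElem_sum_tail_iff hdeg hn _).1 ?_ r hr
  rw [← eq_sum_tailCoord]
  exact ε.2

-- The last basis vector is the constant `a_n`, so scalars have only a last coordinate. This is the
-- coordinate that the Hankel matrix does not see.
omit [CharP k 2] in
theorem tailCoord_algebraMap (c : k) {r : ℕ} (hr : r + 1 < n) :
    tailCoord hdeg hn (algebraMap k (AdjoinRoot f) c) r = 0 := by
  have h := tailCoord_eq hdeg hn (fun i => if i + 1 = n then c * (f.coeff n)⁻¹ else 0)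
    (x := algebraMap k (AdjoinRoot f) c) (r := r) ?_ (by omega)
  · rw [h, if_neg (by omega)]
  · rw [Finset.sum_eq_single (n - 1)]
    · rw [Nat.sub_add_cancel (by omega), if_pos rfl, tail_last hdeg,
        Algebra.algebraMap_eq_smul_one, Algebra.algebraMap_eq_smul_one, smul_smul, mul_assoc,
        inv_mul_cancel₀ hn, mul_one]
    · intro i _ hi
      rw [if_neg (by omega), zero_smul]
    · intro h
      simp only [Finset.mem_range] at h
      omega

omit [CharP k 2] in
theorem eq_algebraMap_of_tailCoord (hpos : 0 < n) (x : AdjoinRoot f)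
    (hx : ∀ r, r + 1 < n → tailCoord hdeg hn x r = 0) :
    ∃ c : k, x = algebraMap k (AdjoinRoot f) c := by
  refine ⟨tailCoord hdeg hn x (n - 1) * f.coeff n, ?_⟩
  conv_lhs => rw [eq_sum_tailCoord hdeg hn x]
  rw [Finset.sum_eq_single (n - 1)]
  · rw [Nat.sub_add_cancel (by omega), tail_last hdeg, map_mul, Algebra.smul_def]
  · intro i hi hi'
    have := Finset.mem_range.1 hi
    rw [hx i (by omega), zero_smul]
  · intro h
    simp only [Finset.mem_range] at h
    omega

/-- A scalar that is idempotent in a nontrivial algebra is `0` or `1`; the zero ring needs a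
separate case. -/
theorem mem_zmultiples_unit_iff {A : Type*} [CommRing A] [Algebra k A] (ε : Idem k A) :
    ε ∈ AddSubgroup.zmultiples (Idem.unit k A) ↔ ∃ c : k, (ε : A) = algebraMap k A c := by
  constructor
  · intro h
    obtain ⟨z, rfl⟩ := AddSubgroup.mem_zmultiples_iff.1 h
    exact ⟨(z : k), by simp [Idem.unit]⟩
  · rintro ⟨c, hc⟩
    have h1 : IsIdempotentElem (ε : A) := ε.2
    rcases subsingleton_or_nontrivial A with hA | hA
    · have : ε = 0 := Subtype.ext (Subsingleton.elim _ _)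
      rw [this]; exact AddSubgroup.zero_mem _
    rw [hc, IsIdempotentElem, ← map_mul] at h1
    have h2 : c * c = c := (algebraMap k A).injective h1
    rcases eq_or_ne c 0 with rfl | h0
    · have : ε = 0 := Subtype.ext (by rw [hc, map_zero]; rfl)
      rw [this]; exact AddSubgroup.zero_mem _
    · have h3 : c = 1 := mul_right_cancel₀ h0 (by rw [h2, one_mul])
      have : ε = Idem.unit k A := Subtype.ext (by rw [hc, h3, map_one]; rfl)
      rw [this]; exact AddSubgroup.mem_zmultiples _

/-- A solution of the idempotent equations up to the last one can be corrected by a constant. -/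
theorem exists_idem_tailCoord (hodd : Odd n) (s : ℕ → k)
    (hs : ∀ r, r + 1 < n → s r = sqCoord f n s r) :
    ∃ ε : Idem k (AdjoinRoot f), ∀ r, r + 1 < n → tailCoord hdeg hn ε r = s r := by
  have hnt := nontrivial_adjoinRoot_of_coeff_ne_zero hdeg hn hodd.pos
  have : CharP (AdjoinRoot f) 2 :=
    charP_of_injective_algebraMap (algebraMap k (AdjoinRoot f)).injective 2
  set u := ∑ i ∈ Finset.range n, s i • tail f n (i + 1) with hu
  have hu2 : u ^ 2 + u = ∑ i ∈ Finset.range n, (sqCoord f n s i + s i) • tail f n (i + 1) := by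
    rw [hu, sum_tail_sq hdeg, ← Finset.sum_add_distrib]
    simp only [add_smul]
  -- All equations but the last hold, so `u² + u` is a scalar `c`. Odd dimension yields `x` in `k`
  -- with `x² + x = c`, and then `u + x` is idempotent with the same coordinates except the last.
  obtain ⟨c, hc⟩ := eq_algebraMap_of_tailCoord hdeg hn hodd.pos (u ^ 2 + u) fun r hr => by
    rw [tailCoord_eq hdeg hn _ hu2 (by omega), ← hs r hr, CharTwo.add_self_eq_zero]
  obtain ⟨x, hx⟩ := exists_artinSchreier_root
    (by rw [finrank_adjoinRoot_of_coeff_ne_zero hdeg hn]; exact hodd) u c hc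
  refine ⟨⟨u + algebraMap k _ x, ?_⟩, fun r hr => ?_⟩
  · change (u + algebraMap k _ x) * (u + algebraMap k _ x) = u + algebraMap k _ x
    have h1 : algebraMap k (AdjoinRoot f) x ^ 2 + algebraMap k _ x = algebraMap k _ c := by
      rw [← hx, map_add, map_pow]
    linear_combination hc + h1 + two_mul_eq_zero k (u * algebraMap k _ x)
      - two_mul_eq_zero k u - two_mul_eq_zero k (algebraMap k (AdjoinRoot f) x)
      + two_mul_eq_zero k (algebraMap k (AdjoinRoot f) c)
  · change tailCoord hdeg hn (u + algebraMap k _ x) r = s r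
    rw [tailCoord_add, Pi.add_apply, tailCoord_eq hdeg hn s hu (by omega),
      tailCoord_algebraMap hdeg hn x hr, add_zero]

end Coordinates

namespace IsKroneckerBasis

variable {B : Module.Basis (Fin (m + 1) ⊕ Fin m) k E} (hB : IsKroneckerBasis e q₀ q₁ B)
  (hn : (dehomHalfDisc e q₀ q₁).coeff (2 * m + 1) ≠ 0)

/-- The homomorphism from idempotents to automorphisms given by a Kronecker basis. -/
def idemToAut : Idem k (pencilAlgebra e q₀ q₁) →+ Additive (pairAut q₀ q₁) where
  toFun ε := Additive.ofMul ⟨hankelEquiv hB.inl_eq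
    (tailCoord (natDegree_dehomHalfDisc_le e q₀ q₁) hn (ε : pencilAlgebra e q₀ q₁)),
    hB.hankelEquiv_mem_pairAut _ fun _ hr => tailCoord_idem (natDegree_dehomHalfDisc_le e q₀ q₁) hn
      (Nat.succ_pos _) ε (by omega)⟩
  map_zero' := by
    apply Additive.toMul.injective
    refine Subtype.ext ?_
    refine (hB.hankelEquiv_congr (s' := 0) fun r hr => ?_).trans ?_
    · exact tailCoord_eq _ _ 0 (by simp) (by omega)
    · have h : hankelEquiv hB.inl_eq (0 : ℕ → k) * hankelEquiv hB.inl_eq (0 : ℕ → k) =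
          hankelEquiv hB.inl_eq (0 : ℕ → k) := by
        rw [← hankelEquiv_add, add_zero]
      exact mul_eq_left.1 h
  map_add' ε ε' := by
    apply Additive.toMul.injective
    refine Subtype.ext ?_
    refine Eq.trans ?_ (hankelEquiv_add hB.inl_eq _ _)
    exact congrArg (hankelEquiv hB.inl_eq)
      (tailCoord_add (natDegree_dehomHalfDisc_le e q₀ q₁) hn _ _)

theorem coe_idemToAut (ε : Idem k (pencilAlgebra e q₀ q₁)) :
    ((Additive.toMul (hB.idemToAut hn ε) : pairAut q₀ q₁) : E ≃ₗ[k] E) =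
      hankelEquiv hB.inl_eq
        (tailCoord (natDegree_dehomHalfDisc_le e q₀ q₁) hn (ε : pencilAlgebra e q₀ q₁)) := rfl

theorem idemToAut_surjective (hreg : IsRegularPair e q₀ q₁) :
    Function.Surjective (hB.idemToAut hn) := by
  intro g
  obtain ⟨s, hs, hg⟩ := hB.exists_eq_hankelEquiv hreg hn (Additive.toMul g).2
  obtain ⟨ε, hε⟩ := exists_idem_tailCoord (natDegree_dehomHalfDisc_le e q₀ q₁) hn
    (odd_two_mul_add_one m) s fun r hr => hs r (by omega)
  refine ⟨ε, Additive.toMul.injective (Subtype.ext ?_)⟩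
  rw [coe_idemToAut, hg]
  exact hB.hankelEquiv_congr fun r hr => hε r (by omega)

theorem ker_idemToAut : (hB.idemToAut hn).ker =
    AddSubgroup.zmultiples (Idem.unit k (pencilAlgebra e q₀ q₁)) := by
  ext ε
  rw [AddMonoidHom.mem_ker, mem_zmultiples_unit_iff]
  constructor
  · intro h
    have h1 : hankelEquiv hB.inl_eq (tailCoord (natDegree_dehomHalfDisc_le e q₀ q₁) hn
        (ε : pencilAlgebra e q₀ q₁)) = 1 := by
      rw [← hB.coe_idemToAut hn, h]; rfl
    exact eq_algebraMap_of_tailCoord _ hn (Nat.succ_pos _) _ fun r hr =>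
      hB.eq_zero_of_hankelEquiv_eq_one h1 r (by omega)
  · rintro ⟨c, hc⟩
    rw [← (hB.idemToAut hn).map_zero]
    apply Additive.toMul.injective
    refine Subtype.ext ?_
    rw [coe_idemToAut, coe_idemToAut]
    refine hB.hankelEquiv_congr fun r hr => ?_
    have h0 := tailCoord_algebraMap (natDegree_dehomHalfDisc_le e q₀ q₁) hn 0 (r := r) (by omega)
    rw [map_zero] at h0
    rw [hc, tailCoord_algebraMap (natDegree_dehomHalfDisc_le e q₀ q₁) hn c (by omega)]
    exact h0.symm

/-- The isomorphism `Idem(A)/⟨1⟩ ≅ Aut(q₀, q₁)` constructed from a Kronecker basis. -/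
def idemQuotEquiv (hreg : IsRegularPair e q₀ q₁) :
    Multiplicative (IdemQuot k (pencilAlgebra e q₀ q₁)) ≃* pairAut q₀ q₁ :=
  AddEquiv.toMultiplicativeLeft ((QuotientAddGroup.quotientAddEquivOfEq
    (hB.ker_idemToAut hn).symm).trans
    (QuotientAddGroup.quotientKerEquivOfSurjective _ (hB.idemToAut_surjective hn hreg)))

theorem idemQuotEquiv_mk (hreg : IsRegularPair e q₀ q₁) (ε : Idem k (pencilAlgebra e q₀ q₁)) :
    hB.idemQuotEquiv hn hreg (Multiplicative.ofAdd (QuotientAddGroup.mk ε)) =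
      Additive.toMul (hB.idemToAut hn ε) := rfl

/-- The isomorphism is given by the same formula in every Kronecker basis. -/
theorem idemQuotEquiv_apply (hreg : IsRegularPair e q₀ q₁)
    {B' : Module.Basis (Fin (m + 1) ⊕ Fin m) k E} (hB' : IsKroneckerBasis e q₀ q₁ B')
    (ε : Idem k (pencilAlgebra e q₀ q₁)) (s : ℕ → k)
    (hε : (ε : pencilAlgebra e q₀ q₁) = ∑ i ∈ Finset.range (2 * m + 1), s i • dElem e q₀ q₁ i) :
    (∀ i : Fin (m + 1), (hB.idemQuotEquiv hn hreg
      (Multiplicative.ofAdd (QuotientAddGroup.mk ε)) : E ≃ₗ[k] E) (B' (.inl i)) = B' (.inl i)) ∧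
    ∀ i : Fin m, (hB.idemQuotEquiv hn hreg
      (Multiplicative.ofAdd (QuotientAddGroup.mk ε)) : E ≃ₗ[k] E) (B' (.inr i)) =
        B' (.inr i) + ∑ j : Fin (m + 1), s ((i : ℕ) + (j : ℕ)) • B' (.inl j) := by
  have hs : hankelEquiv hB.inl_eq (tailCoord (natDegree_dehomHalfDisc_le e q₀ q₁) hn
      (ε : pencilAlgebra e q₀ q₁)) = hankelEquiv hB.inl_eq s :=
    hB.hankelEquiv_congr fun r hr => tailCoord_eq _ hn s
      (by simpa only [dElem_eq_tail] using hε) (by omega)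
  rw [idemQuotEquiv_mk, coe_idemToAut, hs]
  have hinl : ∀ i, B' (.inl i) = B (.inl i) := fun i => by rw [hB.inl_eq, hB'.inl_eq]
  have hfix : ∀ i, hankelEquiv hB.inl_eq s (B (.inl i)) = B (.inl i) := fun i => by
    rw [hankelEquiv_apply, hankelMap_inl, add_zero]
  refine ⟨fun i => by rw [hinl, hfix], fun i => ?_⟩
  -- Two Kronecker bases share the `w_j` by normalization, and their `v_i` differ by a vector
  -- orthogonal to the `w_l`, thus by a combination of the `w_j`, which is fixed. So the formula
  -- does not depend on the basis.
  have hdiff : hankelEquiv hB.inl_eq s (B' (.inr i) - B (.inr i)) = B' (.inr i) - B (.inr i) := by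
    rw [hB.eq_sum_inl (B' (.inr i) - B (.inr i)) fun l => by
      rw [QuadraticMap.polar_sub_right, hB.wv₁, ← hinl, hB'.wv₁, sub_self], map_sum]
    exact Finset.sum_congr rfl fun j _ => by rw [map_smul, hfix]
  have h1 : B' (.inr i) = B (.inr i) + (B' (.inr i) - B (.inr i)) := by abel
  rw [h1, map_add, hdiff, hankelEquiv_apply, hankelMap_inr, Finset.sum_range]
  simp only [hinl, hB.inl_eq]
  abel

end IsKroneckerBasis

theorem card_zmultiples_unit {A : Type*} [CommRing A] [Algebra k A] [Nontrivial A] :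
    Nat.card (AddSubgroup.zmultiples (Idem.unit k A)) = 2 := by
  rw [Nat.card_zmultiples]
  refine addOrderOf_eq_prime (Subtype.ext ?_) fun h => one_ne_zero (congrArg Subtype.val h)
  have := two_mul_eq_zero k (1 : A)
  simpa [Idem.unit, two_nsmul, one_add_one_eq_two] using this

end QuadPencil

end

/-! ### Counting idempotents -/

noncomputable section

namespace QuadPencil

/-- Idempotents correspond to clopen subsets of the spectrum, which is finite and discrete for an
Artinian ring. -/
theorem card_isIdempotentElem (R : Type*) [CommRing R] [IsArtinianRing R] :
    Nat.card {x : R // IsIdempotentElem x} = 2 ^ Nat.card (PrimeSpectrum R) := by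
  rw [Nat.card_congr PrimeSpectrum.isIdempotentElemEquivClopens.toEquiv]
  let φ : TopologicalSpace.Clopens (PrimeSpectrum R) ≃ Set (PrimeSpectrum R) :=
    { toFun := fun s => s
      invFun := fun s => ⟨s, isClopen_discrete s⟩
      left_inv := fun _ => rfl
      right_inv := fun _ => rfl }
  rw [Nat.card_congr φ]
  have := Fintype.ofFinite (PrimeSpectrum R)
  rw [Nat.card_eq_fintype_card, Nat.card_eq_fintype_card, Fintype.card_set]

variable {k : Type*} [Field k]

/-- Primes of the quotient are the primes of `k[X]` containing `f`. As `f ≠ 0` none of them is zero,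
so each has a unique monic irreducible generator. -/
theorem card_primeSpectrum_adjoinRoot {f : k[X]} (hf : f ≠ 0) :
    Nat.card (PrimeSpectrum (AdjoinRoot f)) =
      {p : k[X] | p.Monic ∧ Irreducible p ∧ p ∣ f}.ncard := by
  classical
  have hker : RingHom.ker (AdjoinRoot.mk f) = Ideal.span {f} := Ideal.mk_ker
  rw [Nat.card_congr (Ideal.primeSpectrumOrderIsoZeroLocusOfSurj (AdjoinRoot.mk f)
    AdjoinRoot.mk_surjective hker).toEquiv, ← Nat.card_coe_set_eq]
  symm
  let φ : {p : k[X] | p.Monic ∧ Irreducible p ∧ p ∣ f} →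
      PrimeSpectrum.zeroLocus ((Ideal.span {f} : Ideal k[X]) : Set k[X]) := fun p =>
    ⟨⟨Ideal.span {p.1}, (Ideal.span_singleton_prime p.2.2.1.ne_zero).2 p.2.2.1.prime⟩, by
      rw [PrimeSpectrum.mem_zeroLocus, SetLike.coe_subset_coe, Ideal.span_singleton_le_span_singleton]
      exact p.2.2.2⟩
  refine Nat.card_congr (Equiv.ofBijective φ ⟨?_, ?_⟩)
  · rintro ⟨p, hp⟩ ⟨q, hq⟩ h
    have h1 : Ideal.span {p} = Ideal.span {q} :=
      congrArg (fun x : PrimeSpectrum.zeroLocus ((Ideal.span {f} : Ideal k[X]) : Set k[X]) =>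
        x.1.asIdeal) h
    rw [Ideal.span_singleton_eq_span_singleton] at h1
    exact Subtype.ext (eq_of_monic_of_associated hp.1 hq.1 h1)
  · rintro ⟨⟨I, hI⟩, hfI⟩
    obtain ⟨g, rfl⟩ := (IsPrincipalIdealRing.principal I).principal
    rw [PrimeSpectrum.mem_zeroLocus, SetLike.coe_subset_coe] at hfI
    have hgf : g ∣ f := Ideal.span_singleton_le_span_singleton.1 hfI
    have hg0 : g ≠ 0 := ne_zero_of_dvd_ne_zero hf hgf
    have hg : Prime g := (Ideal.span_singleton_prime hg0).1 hI
    refine ⟨⟨normalize g, monic_normalize hg0, ?_, ?_⟩, ?_⟩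
    · exact (normalize_associated g).irreducible_iff.2 hg.irreducible
    · exact (normalize_associated g).dvd.trans hgf
    · refine Subtype.ext (PrimeSpectrum.ext ?_)
      exact Ideal.span_singleton_eq_span_singleton.2 (normalize_associated g)

theorem card_idem_adjoinRoot [CharP k 2] {f : k[X]} (hf : f ≠ 0) :
    Nat.card (Idem k (AdjoinRoot f)) =
      2 ^ {p : k[X] | p.Monic ∧ Irreducible p ∧ p ∣ f}.ncard := by
  have : Module.Finite k (AdjoinRoot f) := (AdjoinRoot.powerBasis hf).finite
  have : IsArtinianRing (AdjoinRoot f) := IsArtinianRing.of_finite k _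
  rw [← card_primeSpectrum_adjoinRoot hf]
  exact card_isIdempotentElem (AdjoinRoot f)

end QuadPencil

end

theorem mainTheorem7 {k : Type*} [Field k] [CharP k 2] {E : Type*} [AddCommGroup E] [Module k E]
    (m : ℕ) (hm : 1 ≤ m) (e : Module.Basis (Fin (2 * m + 1)) k E)
    (q₀ q₁ : QuadraticForm k E) (hreg : IsRegularPair e q₀ q₁)
    (hn : (dehomHalfDisc e q₀ q₁).coeff (2 * m + 1) ≠ 0) :
    (∃ Ψ : Multiplicative (IdemQuot k (pencilAlgebra e q₀ q₁)) ≃* pairAut q₀ q₁,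
      (∃ B, IsKroneckerBasis e q₀ q₁ B) ∧
      ∀ B, IsKroneckerBasis e q₀ q₁ B →
        ∀ (ε : Idem k (pencilAlgebra e q₀ q₁)) (s : ℕ → k),
          (ε : pencilAlgebra e q₀ q₁) =
              ∑ i ∈ Finset.range (2 * m + 1), s i • dElem e q₀ q₁ i →
          (∀ i : Fin (m + 1),
            (Ψ (Multiplicative.ofAdd (QuotientAddGroup.mk ε)) : E ≃ₗ[k] E) (B (.inl i)) =
              B (.inl i)) ∧
          (∀ i : Fin m,
            (Ψ (Multiplicative.ofAdd (QuotientAddGroup.mk ε)) : E ≃ₗ[k] E) (B (.inr i)) =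
              B (.inr i) + ∑ j : Fin (m + 1), s ((i : ℕ) + (j : ℕ)) • B (.inl j))) ∧
    (∀ g h : pairAut q₀ q₁, g * h = h * g) ∧
    (∀ g : pairAut q₀ q₁, g ^ 2 = 1) ∧
    Nat.card (pairAut q₀ q₁) =
      2 ^ ({p : k[X] | p.Monic ∧ Irreducible p ∧ p ∣ dehomHalfDisc e q₀ q₁}.ncard - 1) := by
  obtain ⟨B, hB⟩ := exists_isKroneckerBasis e q₀ q₁ hreg (radVec_ne_zero hn)
  have hsurj := hB.idemToAut_surjective hn hreg
  refine ⟨⟨hB.idemQuotEquiv hn hreg, ⟨B, hB⟩, fun B' hB' ε s hε =>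
    hB.idemQuotEquiv_apply hn hreg hB' ε s hε⟩, fun g h => ?_, fun g => ?_, ?_⟩
  · obtain ⟨a, ha⟩ := hsurj (Additive.ofMul g)
    obtain ⟨b, hb⟩ := hsurj (Additive.ofMul h)
    apply Additive.ofMul.injective
    rw [ofMul_mul, ofMul_mul, ← ha, ← hb, ← map_add, ← map_add, add_comm]
  · obtain ⟨a, ha⟩ := hsurj (Additive.ofMul g)
    have h2 : a + a = 0 := Subtype.ext (by
      have := two_mul_eq_zero k (a : pencilAlgebra e q₀ q₁)
      rwa [two_mul] at this)
    apply Additive.ofMul.injective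
    rw [sq, ofMul_mul, ← ha, ← map_add, h2, map_zero]
    rfl
  · have hf : dehomHalfDisc e q₀ q₁ ≠ 0 := by
      intro h
      rw [h, coeff_zero] at hn
      exact hn rfl
    have : Nontrivial (pencilAlgebra e q₀ q₁) := nontrivial_adjoinRoot_of_coeff_ne_zero
      (natDegree_dehomHalfDisc_le e q₀ q₁) hn (Nat.succ_pos _)
    have h1 := AddSubgroup.card_eq_card_quotient_mul_card_addSubgroup
      (AddSubgroup.zmultiples (Idem.unit k (pencilAlgebra e q₀ q₁)))
    rw [card_zmultiples_unit, card_idem_adjoinRoot hf] at h1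
    have h2 : Nat.card (pairAut q₀ q₁) = Nat.card (IdemQuot k (pencilAlgebra e q₀ q₁)) :=
      (Nat.card_congr (hB.idemQuotEquiv hn hreg).toEquiv).symm
    rw [h2]
    -- The number of factors is positive, since otherwise `1` would be twice the order of the
    -- quotient; this makes the truncated subtraction in the exponent harmless.
    cases hl : {p : k[X] | p.Monic ∧ Irreducible p ∧ p ∣ dehomHalfDisc e q₀ q₁}.ncard with
    | zero => rw [hl, pow_zero] at h1; omega
    | succ l => rw [hl, pow_succ] at h1; exact (mul_right_cancel₀ two_ne_zero h1).symm
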